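/- Let $n\ge 1$ and let $H^n=\mathbb R^n\times\mathbb R^n\times\mathbb R$ be the Heisenberg group with coordinates $(x,y,t)$ and Lebesgue measure, $X_i=\partial_{x_i}+2y_i\partial_t$, $Y_i=\partial_{y_i}-2x_i\partial_t$, $\nabla_H=(X_1,\dots,X_n,Y_1,\dots,Y_n)$, $\Delta_H=\sum_i (X_i^2+Y_i^2)$, $Q=2n+2$, and let $1\le p<\frac{Q+2}{Q-2}$. Let $S=S_1^2(H^n)$ be the completion of $C_0^\infty(H^n)$ for the norm $\|u\|=\|\nabla_H u\|_{L^2}$, regarded as a space of functions in $L^{2Q/(Q-2)}(H^n)$. Put $$M=\Big\{u\in S:\ \tfrac1{p+1}\int_{H^n}|u|^{p+1}=1\Big\},\qquad I(u)=\tfrac12\int_{H^n}|\nabla_H u|^2 .$$ Let $B_R=\{(x,y,t):(t^2+(|x|^2+|y|^2)^2)^{1/2}<R\}$; for each integer $k>1$ let $\rho_k\in C_0^\infty(B_{k+1})$ with $\rho_k=1$ on $B_k$, and let $\pi_k u=\rho_k u$ for $u\in S$. A tangent vector to $M$ at $u\in M$ is the velocity $\gamma'(0)\in S$ of a $C^1$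 curve $\gamma$ in $S$ that lies in $M$, with $\gamma(0)=u$. The derivative $(I|_M)'(u)$ is the restriction of $I'(u)$ to the tangent vectors, and $\|(I|_M)'(u)\|$ is the supremum of $|I'(u)v|$ over the tangent vectors $v$ with $\|v\|\le1$. A point $u\in M$ is a critical point of $I$ on $M$ if $(I|_M)'(u)=0$. It is a generalized critical point of $I$ on $M$ if there is a sequence $(u_j)$ in $M$ with $\|(I|_M)'(u_j)\|\to0$ and $\|\pi_k(u_j-u)\|\to0$ for every $k>1$. Then every generalized critical point $u$ of $I$ on $M$ is a critical point of $I$ on $M$. Moreover, if $p>1$, there is $c>0$ such that $w=cu$ is a weak solution of $-\Delta_H w=|w|^{p-1}w$, that is, $\int_{H^n}\nabla_H w\cdot\nabla_H v=\int_{H^n}|w|^{p-1}w\,v$ for all $v\in S\cap L^{p+1}(H^n)$. -/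

import Mathlib

open MeasureTheory Filter Topology Set
open scoped ENNReal ContDiff

noncomputable section

/-! ### The Heisenberg group `H^n` in real coordinates, and its horizontal gradient -/

/-- The underlying space of `H^n`, with real coordinates `(x, y, t)`; its Haar measure is the
Lebesgue measure `volume`. -/
abbrev Heis (n : ℕ) : Type := (Fin n → ℝ) × (Fin n → ℝ) × ℝ

/-- The fibre of horizontal vectors: coordinates along `X_1, …, X_n, Y_1, …, Y_n`, with the
Euclidean norm. -/
abbrev HVec (n : ℕ) : Type := EuclideanSpace ℝ (Fin n ⊕ Fin n)

/-- The homogeneous dimension `Q = 2 n + 2`. -/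
def homDim (n : ℕ) : ℕ := 2 * n + 2

/-- The vector field `X_i = ∂/∂x_i + 2 y_i ∂/∂t` at `z`, as a tangent vector. -/
def vecX {n : ℕ} (i : Fin n) (z : Heis n) : Heis n := (Pi.single i 1, 0, 2 * z.2.1 i)

/-- The vector field `Y_i = ∂/∂y_i - 2 x_i ∂/∂t` at `z`, as a tangent vector. -/
def vecY {n : ℕ} (i : Fin n) (z : Heis n) : Heis n := (0, Pi.single i 1, -(2 * z.1 i))

/-- The horizontal gradient `∇_H φ = (X_1 φ, …, X_n φ, Y_1 φ, …, Y_n φ)`. -/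
def hgrad {n : ℕ} (φ : Heis n → ℝ) (z : Heis n) : HVec n :=
  WithLp.toLp 2 (Sum.elim (fun i => fderiv ℝ φ z (vecX i z)) (fun i => fderiv ℝ φ z (vecY i z)))

/-- `φ ∈ C_0^∞(H^n)`. -/
def IsTest {n : ℕ} (φ : Heis n → ℝ) : Prop := ContDiff ℝ ∞ φ ∧ HasCompactSupport φ

/-- The critical Sobolev exponent `2 Q / (Q - 2)` of `H^n`. -/
def sobExp (n : ℕ) : ℝ≥0∞ := ENNReal.ofReal (2 * (homDim n : ℝ) / ((homDim n : ℝ) - 2))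

/-! ### Elementary facts used to build the spaces -/

theorem sobExp_aux (n : ℕ) [NeZero n] : (0 : ℝ) < (homDim n : ℝ) - 2 := by
  have : 0 < n := Nat.pos_of_ne_zero (NeZero.ne n)
  have : (0 : ℝ) < n := by exact_mod_cast this
  simp only [homDim]; push_cast; linarith

instance sobExp_fact (n : ℕ) [NeZero n] : Fact (1 ≤ sobExp n) := by
  refine ⟨?_⟩
  have h := sobExp_aux n
  rw [sobExp, ← ENNReal.ofReal_one]
  refine ENNReal.ofReal_le_ofReal ?_
  rw [le_div_iff₀ h]; linarith

instance homDim_fact (n : ℕ) : Fact ((1 : ℝ≥0∞) ≤ (homDim n : ℝ≥0∞)) := by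
  refine ⟨?_⟩
  have : 1 ≤ homDim n := by simp only [homDim]; omega
  exact_mod_cast this

instance sobExp_holder (n : ℕ) [NeZero n] :
    ENNReal.HolderTriple (sobExp n) (homDim n : ℝ≥0∞) 2 := by
  refine ⟨?_⟩
  have h := sobExp_aux n
  have h0 : (0 : ℝ) < homDim n := by linarith
  have h1 : (0 : ℝ) < 2 * (homDim n : ℝ) / ((homDim n : ℝ) - 2) := by positivity
  have h2 : (homDim n : ℝ≥0∞) = ENNReal.ofReal (homDim n : ℝ) := by simp
  have h3 : (2 : ℝ≥0∞) = ENNReal.ofReal 2 := by simp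
  rw [sobExp, h2, h3, ← ENNReal.ofReal_inv_of_pos h1, ← ENNReal.ofReal_inv_of_pos h0,
    ← ENNReal.ofReal_inv_of_pos two_pos, ← ENNReal.ofReal_add (by positivity) (by positivity)]
  congr 1
  field_simp
  ring

theorem IsTest.differentiable {n : ℕ} {φ : Heis n → ℝ} (hφ : IsTest φ) : Differentiable ℝ φ :=
  hφ.1.differentiable (by simp)

theorem hgrad_add {n : ℕ} {φ ψ : Heis n → ℝ} (hφ : Differentiable ℝ φ) (hψ : Differentiable ℝ ψ)
    (z : Heis n) : hgrad (φ + ψ) z = hgrad φ z + hgrad ψ z := by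
  ext i
  rcases i with i | i <;> simp [hgrad, fderiv_add (hφ z) (hψ z)]

theorem hgrad_smul {n : ℕ} {φ : Heis n → ℝ} (hφ : Differentiable ℝ φ) (c : ℝ)
    (z : Heis n) : hgrad (c • φ) z = c • hgrad φ z := by
  ext i
  rcases i with i | i <;> simp [hgrad, fderiv_const_smul (hφ z)]

theorem hgrad_mul {n : ℕ} {φ ψ : Heis n → ℝ} (hφ : Differentiable ℝ φ) (hψ : Differentiable ℝ ψ)
    (z : Heis n) : hgrad (φ * ψ) z = φ z • hgrad ψ z + ψ z • hgrad φ z := by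
  ext i
  rcases i with i | i <;> simp [hgrad, fderiv_mul (hφ z) (hψ z)]

theorem IsTest.continuous_hgrad {n : ℕ} {φ : Heis n → ℝ} (hφ : IsTest φ) :
    Continuous (hgrad φ) := by
  have h1 : Continuous (fderiv ℝ φ) := hφ.1.continuous_fderiv (by simp)
  refine (PiLp.continuous_toLp 2 _).comp (continuous_pi fun i => ?_)
  rcases i with i | i
  · exact h1.clm_apply (by unfold vecX; fun_prop)
  · exact h1.clm_apply (by unfold vecY; fun_prop)

theorem IsTest.hasCompactSupport_hgrad {n : ℕ} {φ : Heis n → ℝ} (hφ : IsTest φ) :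
    HasCompactSupport (hgrad φ) := by
  refine (hφ.2.fderiv (𝕜 := ℝ)).mono fun z hz => ?_
  rw [Function.mem_support] at hz ⊢
  intro h
  apply hz
  ext i
  rcases i with i | i <;> simp [hgrad, h]

theorem IsTest.memLp {n : ℕ} {φ : Heis n → ℝ} (hφ : IsTest φ) (q : ℝ≥0∞) :
    MemLp φ q volume := hφ.1.continuous.memLp_of_hasCompactSupport hφ.2

theorem IsTest.memLp_hgrad {n : ℕ} {φ : Heis n → ℝ} (hφ : IsTest φ) (q : ℝ≥0∞) :
    MemLp (hgrad φ) q volume := hφ.continuous_hgrad.memLp_of_hasCompactSupport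
      hφ.hasCompactSupport_hgrad

theorem IsTest.mul {n : ℕ} {φ ψ : Heis n → ℝ} (hφ : IsTest φ) (hψ : IsTest ψ) :
    IsTest (φ * ψ) := ⟨hφ.1.mul hψ.1, hψ.2.mul_left⟩

/-! ### The Folland-Stein space `S_1^2(H^n)`

The completion of `C_0^∞(H^n)` for `‖∇_H φ‖_{L^2}` is realized as a space of functions: by the
Folland-Stein inequality the completion embeds in `L^{2Q/(Q-2)}`, so its elements are the limits
in `L^{2Q/(Q-2)}` of sequences of test functions whose gradients converge in `L^2`. An element is
carried together with its horizontal gradient. -/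

/-- All pairs `(φ, ∇_H φ)` with `φ ∈ C_0^∞(H^n)`. -/
def testGraph (n : ℕ) [NeZero n] :
    Submodule ℝ (Lp ℝ (sobExp n) (volume : Measure (Heis n)) ×
      Lp (HVec n) 2 (volume : Measure (Heis n))) where
  carrier := {w | ∃ φ : Heis n → ℝ, IsTest φ ∧ w.1 =ᵐ[volume] φ ∧ w.2 =ᵐ[volume] hgrad φ}
  add_mem' := by
    rintro a b ⟨φ, hφ, ha1, ha2⟩ ⟨ψ, hψ, hb1, hb2⟩
    refine ⟨φ + ψ, ⟨hφ.1.add hψ.1, hφ.2.add hψ.2⟩, ?_, ?_⟩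
    · filter_upwards [Lp.coeFn_add a.1 b.1, ha1, hb1] with z h1 h2 h3
      rw [Prod.fst_add, h1, Pi.add_apply, Pi.add_apply, h2, h3]
    · filter_upwards [Lp.coeFn_add a.2 b.2, ha2, hb2] with z h1 h2 h3
      rw [Prod.snd_add, h1, Pi.add_apply, h2, h3, hgrad_add hφ.differentiable hψ.differentiable]
  zero_mem' := by
    refine ⟨0, ⟨contDiff_const, HasCompactSupport.zero⟩, Lp.coeFn_zero _ _ _, ?_⟩
    filter_upwards [Lp.coeFn_zero (HVec n) 2 (volume : Measure (Heis n))] with z h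
    rw [Prod.snd_zero, h]
    ext i
    rcases i with i | i <;> simp [hgrad]
  smul_mem' := by
    rintro c a ⟨φ, hφ, ha1, ha2⟩
    refine ⟨c • φ, ⟨contDiff_const.smul hφ.1, hφ.2.smul_left (f := fun _ => c)⟩, ?_, ?_⟩
    · filter_upwards [Lp.coeFn_smul c a.1, ha1] with z h1 h2
      simp [h1, h2]
    · filter_upwards [Lp.coeFn_smul c a.2, ha2] with z h1 h2
      simp [h1, h2, hgrad_smul hφ.differentiable]

/-- Translation along the flow of `X_i` for time `s`. -/
def flowX {n : ℕ} (i : Fin n) (s : ℝ) (z : Heis n) : Heis n := z + s • vecX i z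

theorem continuous_flowX {n : ℕ} (i : Fin n) : Continuous fun w : ℝ × Heis n => flowX i w.1 w.2 := by
  unfold flowX vecX; fun_prop

theorem measurePreserving_flowX {n : ℕ} (i : Fin n) (s : ℝ) :
    MeasurePreserving (flowX i s) (volume : Measure (Heis n)) volume := by
  have h1 : MeasurePreserving (fun x : Fin n → ℝ => x + s • Pi.single i 1) volume volume :=
    measurePreserving_add_right volume _
  have h2 : MeasurePreserving (fun w : (Fin n → ℝ) × ℝ => (w.1, w.2 + s * (2 * w.1 i)))
      (volume.prod volume) (volume.prod volume) := by
    refine MeasurePreserving.skew_product (g := fun (y : Fin n → ℝ) (t : ℝ) => t + s * (2 * y i))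
      (MeasurePreserving.id _) (by unfold Function.uncurry; fun_prop) (ae_of_all _ fun y => ?_)
    exact (measurePreserving_add_right volume _).map_eq
  have h3 : flowX i s = Prod.map (fun x : Fin n → ℝ => x + s • Pi.single i 1)
      (fun w : (Fin n → ℝ) × ℝ => (w.1, w.2 + s * (2 * w.1 i))) := by
    funext z
    rcases z with ⟨x, y, t⟩
    simp [flowX, vecX]
  rw [h3]
  exact h1.prod h2

theorem hasDerivAt_flowX {n : ℕ} (i : Fin n) {φ : Heis n → ℝ} (hφ : IsTest φ) (z : Heis n)
    (r : ℝ) : HasDerivAt (fun s => φ (flowX i s z)) (hgrad φ (flowX i r z) (Sum.inl i)) r := by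
  have h1 : HasDerivAt (fun s : ℝ => flowX i s z) (vecX i z) r := by
    unfold flowX
    simpa using ((hasDerivAt_id r).smul_const (vecX i z)).const_add z
  have h2 := (hφ.differentiable (flowX i r z)).hasFDerivAt.comp_hasDerivAt r h1
  have h3 : vecX i (flowX i r z) = vecX i z := by simp [vecX, flowX]
  rw [← h3] at h2
  exact h2

/-- `‖φ ∘ τ_s - φ‖_2 ≤ s ‖∇_H φ‖_2`. -/
theorem lintegral_flowX_sub_le {n : ℕ} (i : Fin n) {φ : Heis n → ℝ} (hφ : IsTest φ) {s : ℝ}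
    (hs : 0 ≤ s) :
    ∫⁻ z, ‖φ (flowX i s z) - φ z‖ₑ ^ (2 : ℝ) ≤
      ENNReal.ofReal s ^ (2 : ℝ) * ∫⁻ z, ‖hgrad φ z‖ₑ ^ (2 : ℝ) := by
  have hc : Continuous fun w : ℝ × Heis n => hgrad φ (flowX i w.1 w.2) :=
    hφ.continuous_hgrad.comp (continuous_flowX i)
  have hvol : (volume.restrict (Ioc 0 s)) Set.univ = ENNReal.ofReal s := by simp
  have key : ∀ z : Heis n, ‖φ (flowX i s z) - φ z‖ₑ ^ (2 : ℝ) ≤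
      ENNReal.ofReal s * ∫⁻ r in Ioc 0 s, ‖hgrad φ (flowX i r z)‖ₑ ^ (2 : ℝ) := by
    intro z
    have hcz : Continuous fun r => hgrad φ (flowX i r z) := hc.comp (Continuous.prodMk_left z)
    have hci : Continuous fun r => hgrad φ (flowX i r z) (Sum.inl i) :=
      (continuous_apply (Sum.inl i)).comp ((PiLp.continuous_ofLp 2 _).comp hcz)
    have e1 : φ (flowX i s z) - φ z = ∫ r in Ioc 0 s, hgrad φ (flowX i r z) (Sum.inl i) := by
      rw [← intervalIntegral.integral_of_le hs,
        intervalIntegral.integral_eq_sub_of_hasDerivAt (fun r _ => hasDerivAt_flowX i hφ z r)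
          (hci.intervalIntegrable 0 s)]
      simp [flowX]
    have e2 : ‖φ (flowX i s z) - φ z‖ₑ ≤ ∫⁻ r in Ioc 0 s, ‖hgrad φ (flowX i r z)‖ₑ := by
      rw [e1]
      refine (enorm_integral_le_lintegral_enorm _).trans (lintegral_mono fun r => ?_)
      rw [enorm_le_iff_norm_le]
      exact PiLp.norm_apply_le _ _
    have e3 := ENNReal.lintegral_mul_le_Lp_mul_Lq (volume.restrict (Ioc 0 s))
      Real.HolderConjugate.two_two (f := fun _ => 1)
      (g := fun r => ‖hgrad φ (flowX i r z)‖ₑ) aemeasurable_const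
      hcz.enorm.measurable.aemeasurable
    simp only [Pi.mul_apply, one_mul, ENNReal.one_rpow, lintegral_const, hvol] at e3
    calc ‖φ (flowX i s z) - φ z‖ₑ ^ (2 : ℝ)
        ≤ (ENNReal.ofReal s ^ (1 / (2 : ℝ)) *
            (∫⁻ r in Ioc 0 s, ‖hgrad φ (flowX i r z)‖ₑ ^ (2 : ℝ)) ^ (1 / (2 : ℝ))) ^ (2 : ℝ) :=
          ENNReal.rpow_le_rpow (e2.trans e3) (by norm_num)
      _ = _ := by
          rw [ENNReal.mul_rpow_of_nonneg _ _ (by norm_num), ← ENNReal.rpow_mul,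
            ← ENNReal.rpow_mul]
          norm_num
  calc ∫⁻ z, ‖φ (flowX i s z) - φ z‖ₑ ^ (2 : ℝ)
      ≤ ∫⁻ z, ENNReal.ofReal s * ∫⁻ r in Ioc 0 s, ‖hgrad φ (flowX i r z)‖ₑ ^ (2 : ℝ) :=
        lintegral_mono key
    _ = ENNReal.ofReal s * ∫⁻ z, ∫⁻ r in Ioc 0 s, ‖hgrad φ (flowX i r z)‖ₑ ^ (2 : ℝ) :=
        lintegral_const_mul' _ _ ENNReal.ofReal_ne_top
    _ = ENNReal.ofReal s * ∫⁻ r in Ioc 0 s, ∫⁻ z, ‖hgrad φ (flowX i r z)‖ₑ ^ (2 : ℝ) := by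
        rw [lintegral_lintegral_swap]
        exact ((hc.comp continuous_swap).enorm.measurable.pow_const _).aemeasurable
    _ = ENNReal.ofReal s * ∫⁻ r in Ioc 0 s, ∫⁻ z, ‖hgrad φ z‖ₑ ^ (2 : ℝ) := by
        congr 1
        refine lintegral_congr fun r => ?_
        exact (measurePreserving_flowX i r).lintegral_comp
          (f := fun z => ‖hgrad φ z‖ₑ ^ (2 : ℝ))
          (hφ.continuous_hgrad.enorm.measurable.pow_const _)
    _ = _ := by
        rw [lintegral_const, hvol, mul_comm _ (ENNReal.ofReal s), ← mul_assoc]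
        congr 1
        rw [ENNReal.rpow_two, sq]

/-- A limit of test functions whose horizontal gradients tend to `0` is invariant along `X_i`. -/
theorem comp_flowX_of_mem_closure {n : ℕ} [NeZero n] (i : Fin n)
    {w : Lp ℝ (sobExp n) (volume : Measure (Heis n)) ×
      Lp (HVec n) 2 (volume : Measure (Heis n))}
    (hw : w ∈ (testGraph n).topologicalClosure) (h0 : w.2 = 0) {s : ℝ} (hs : 0 ≤ s) :
    (fun z => w.1 (flowX i s z)) =ᵐ[volume] w.1 := by
  obtain ⟨v, hv, hlim⟩ := mem_closure_iff_seq_limit.1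
    (show w ∈ closure ((testGraph n : Submodule ℝ _) : Set _) from hw)
  choose φ hφ hφ1 hφ2 using hv
  have mp := measurePreserving_flowX i s
  have l1 : Tendsto (fun m => (v m).1) atTop (𝓝 w.1) := (continuous_fst.tendsto w).comp hlim
  have l2 : Tendsto (fun m => (v m).2) atTop (𝓝 0) := h0 ▸ (continuous_snd.tendsto w).comp hlim
  let T := Lp.compMeasurePreservingₗᵢ ℝ (E := ℝ) (p := sobExp n) (flowX i s) mp
  have l3 : Tendsto (fun m => T (v m).1 - (v m).1) atTop (𝓝 (T w.1 - w.1)) :=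
    ((T.continuous.tendsto _).comp l1).sub l1
  have m1 := tendstoInMeasure_of_tendsto_Lp l3
  have hT : ∀ f : Lp ℝ (sobExp n) (volume : Measure (Heis n)),
      T f =ᵐ[volume] f ∘ flowX i s := fun f => Lp.coeFn_compMeasurePreserving f mp
  have e : ∀ m, (T (v m).1 - (v m).1 : Lp ℝ (sobExp n) (volume : Measure (Heis n)))
      =ᵐ[volume] fun z => φ m (flowX i s z) - φ m z := by
    intro m
    filter_upwards [Lp.coeFn_sub (T (v m).1) (v m).1, hT (v m).1, hφ1 m,
      mp.quasiMeasurePreserving.ae_eq_comp (hφ1 m)] with z a1 a2 a3 a4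
    rw [a1, Pi.sub_apply, a2, a3, a4, Function.comp]
  have m2 : TendstoInMeasure volume
      (fun m => ((T (v m).1 - (v m).1 : Lp ℝ (sobExp n) (volume : Measure (Heis n))) :
        Heis n → ℝ)) atTop (fun _ => (0 : ℝ)) := by
    refine tendstoInMeasure_of_tendsto_eLpNorm (p := 2) (by norm_num)
      (fun m => Lp.aestronglyMeasurable _) aestronglyMeasurable_const ?_
    have b : ∀ m, eLpNorm (((T (v m).1 - (v m).1 : Lp ℝ (sobExp n) (volume : Measure (Heis n))) :
        Heis n → ℝ) - fun _ => 0) 2 volume ≤ ENNReal.ofReal s * ‖(v m).2‖ₑ := by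
      intro m
      have c1 : eLpNorm (((T (v m).1 - (v m).1 : Lp ℝ (sobExp n) (volume : Measure (Heis n))) :
        Heis n → ℝ) - fun _ => 0) 2 volume =
          eLpNorm (fun z => φ m (flowX i s z) - φ m z) 2 volume := by
        refine eLpNorm_congr_ae ?_
        filter_upwards [e m] with z hz
        simpa using hz
      rw [c1, Lp.enorm_def, eLpNorm_congr_ae (hφ2 m),
        eLpNorm_eq_lintegral_rpow_enorm_toReal (by norm_num) (by norm_num),
        eLpNorm_eq_lintegral_rpow_enorm_toReal (by norm_num) (by norm_num)]
      simp only [ENNReal.toReal_ofNat]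
      refine (ENNReal.rpow_le_rpow (lintegral_flowX_sub_le i (hφ m) hs) (by norm_num)).trans ?_
      rw [ENNReal.mul_rpow_of_nonneg _ _ (by norm_num), ← ENNReal.rpow_mul]
      norm_num
    refine tendsto_of_tendsto_of_tendsto_of_le_of_le tendsto_const_nhds ?_
      (fun _ => zero_le) b
    have c2 : Tendsto (fun m => ‖(v m).2‖ₑ) atTop (𝓝 0) := by
      have := (continuous_enorm.tendsto (0 : Lp (HVec n) 2 (volume : Measure (Heis n)))).comp l2
      rw [enorm_zero] at this
      exact this
    simpa using ENNReal.Tendsto.const_mul c2 (Or.inr ENNReal.ofReal_ne_top)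
  have := tendstoInMeasure_ae_unique m1 m2
  filter_upwards [this, Lp.coeFn_sub (T w.1) w.1, hT w.1] with z a1 a2 a3
  rw [a2, Pi.sub_apply, a3, Function.comp] at a1
  linarith

/-- A limit of test functions whose horizontal gradients tend to `0` vanishes: `‖∇_H u‖_{L^2}` is
a norm on `S_1^2(H^n)`. -/
theorem fst_eq_zero_of_mem_closure {n : ℕ} [NeZero n]
    {w : Lp ℝ (sobExp n) (volume : Measure (Heis n)) ×
      Lp (HVec n) 2 (volume : Measure (Heis n))}
    (hw : w ∈ (testGraph n).topologicalClosure) (h0 : w.2 = 0) : w.1 = 0 := by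
  let i : Fin n := ⟨0, Nat.pos_of_ne_zero (NeZero.ne n)⟩
  have hq0 : sobExp n ≠ 0 := (zero_lt_one.trans_le (sobExp_fact n).out).ne'
  have hqt : sobExp n ≠ ⊤ := ENNReal.ofReal_ne_top
  have hqr : 0 < (sobExp n).toReal := ENNReal.toReal_pos hq0 hqt
  let F : Heis n → ℝ≥0∞ := fun z => ‖w.1 z‖ₑ ^ (sobExp n).toReal
  have hFm : AEMeasurable F volume := (Lp.aestronglyMeasurable w.1).enorm.pow_const _
  have hFfin : ∫⁻ z, F z ≠ ⊤ :=
    (lintegral_rpow_enorm_lt_top_of_eLpNorm_lt_top hq0 hqt (Lp.eLpNorm_lt_top w.1)).ne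
  -- the integral of `F` vanishes over every slab `|x_i| < R`
  have slab : ∀ R : ℕ, ∫⁻ z in {z : Heis n | |z.1 i| < R}, F z = 0 := by
    intro R
    let K : Set (Heis n) := {z | |z.1 i| < R}
    have hK : MeasurableSet K := (isOpen_lt (by fun_prop) (by fun_prop)).measurableSet
    let A : ℕ → Set (Heis n) := fun m => flowX i (m * (2 * R : ℝ)) ⁻¹' K
    have hA : ∀ m, MeasurableSet (A m) := fun m =>
      (measurePreserving_flowX i _).measurable hK
    have hcoord : ∀ (s : ℝ) (z : Heis n), (flowX i s z).1 i = z.1 i + s := by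
      intro s z; simp [flowX, vecX]
    have hdisj : Pairwise (Function.onFun Disjoint A) := by
      intro a b hab
      refine Set.disjoint_left.2 fun z hza hzb => ?_
      simp only [A, K, mem_preimage, mem_ofPred_eq, hcoord, abs_lt] at hza hzb
      have hR : (0 : ℝ) ≤ R := Nat.cast_nonneg R
      rcases lt_or_gt_of_ne hab with h | h
      · have h' : (a : ℝ) + 1 ≤ b := by exact_mod_cast h
        nlinarith
      · have h' : (b : ℝ) + 1 ≤ a := by exact_mod_cast h
        nlinarith
    have heq : ∀ m, ∫⁻ z in A m, F z = ∫⁻ z in K, F z := by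
      intro m
      have mp := measurePreserving_flowX i (m * (2 * R : ℝ))
      have hinv := comp_flowX_of_mem_closure i hw h0 (s := m * (2 * R : ℝ)) (by positivity)
      have h1 : ∫⁻ z in A m, F z = ∫⁻ z in A m, F (flowX i (m * (2 * R : ℝ)) z) := by
        refine lintegral_congr_ae (ae_restrict_of_ae ?_)
        filter_upwards [hinv] with z hz
        simp only [F, hz]
      rw [h1]
      have h2 := mp.restrict_preimage hK
      have hFm' : AEMeasurable F (volume.restrict K) := hFm.restrict
      rw [← h2.map_eq] at hFm'
      rw [← lintegral_map' hFm' h2.measurable.aemeasurable, h2.map_eq]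
    have hsum : ∑' _ : ℕ, ∫⁻ z in K, F z ≠ ⊤ := by
      have := lintegral_iUnion (μ := (volume : Measure (Heis n))) hA hdisj F
      simp only [heq] at this
      rw [← this]
      exact (lt_of_le_of_lt (setLIntegral_le_lintegral _ _) hFfin.lt_top).ne
    by_contra hne
    exact hsum (ENNReal.tsum_const_eq_top_of_ne_zero hne)
  have hae : ∀ R : ℕ, ∀ᵐ z ∂volume, |(z : Heis n).1 i| < R → F z = 0 := by
    intro R
    have hK : MeasurableSet {z : Heis n | |z.1 i| < R} :=
      (isOpen_lt (by fun_prop) (by fun_prop)).measurableSet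
    have := (lintegral_eq_zero_iff' hFm.restrict).1 (slab R)
    exact (ae_restrict_iff' hK).1 this
  refine (Lp.eq_zero_iff_ae_eq_zero).2 ?_
  filter_upwards [ae_all_iff.2 hae] with z hz
  obtain ⟨R, hR⟩ := exists_nat_gt |z.1 i|
  have := hz R hR
  simpa [F, hqr, hqr.not_gt] using this

/-- The space `S_1^2(H^n)`. -/
def FSSpace (n : ℕ) [NeZero n] : Type := ↥((testGraph n).topologicalClosure)

namespace FSSpace

variable {n : ℕ} [NeZero n]

instance : AddCommGroup (FSSpace n) :=
  inferInstanceAs (AddCommGroup ↥((testGraph n).topologicalClosure))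

instance : Module ℝ (FSSpace n) :=
  inferInstanceAs (Module ℝ ↥((testGraph n).topologicalClosure))

/-- The function underlying an element of `S_1^2(H^n)`. -/
def toFun (u : FSSpace n) : Lp ℝ (sobExp n) (volume : Measure (Heis n)) := u.1.1

/-- The horizontal gradient of an element of `S_1^2(H^n)`, in `L^2`. -/
def grad : FSSpace n →ₗ[ℝ] Lp (HVec n) 2 (volume : Measure (Heis n)) :=
  (LinearMap.snd ℝ _ _).comp ((testGraph n).topologicalClosure).subtype

theorem grad_injective : Function.Injective (grad (n := n)) := by
  rw [← LinearMap.ker_eq_bot, LinearMap.ker_eq_bot']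
  intro u hu
  exact Subtype.ext (Prod.ext (fst_eq_zero_of_mem_closure u.2 hu) hu)

/-- The norm of `S_1^2(H^n)` is `‖u‖ = ‖∇_H u‖_{L^2}`. -/
instance : NormedAddCommGroup (FSSpace n) :=
  NormedAddCommGroup.induced (FSSpace n) _ (grad (n := n)) grad_injective

instance : NormedSpace ℝ (FSSpace n) := NormedSpace.induced ℝ (FSSpace n) _ (grad (n := n))

/-- The map `(u, g) ↦ (ρ u, ρ g + u ∇_H ρ)`. -/
def mulMap {ρ : Heis n → ℝ} (hρ : IsTest ρ) :
    (Lp ℝ (sobExp n) (volume : Measure (Heis n)) × Lp (HVec n) 2 (volume : Measure (Heis n))) →L[ℝ]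
    (Lp ℝ (sobExp n) (volume : Measure (Heis n)) × Lp (HVec n) 2 (volume : Measure (Heis n))) :=
  (((ContinuousLinearMap.lsmul ℝ ℝ).holderL volume ∞ (sobExp n) (sobExp n)
      ((hρ.memLp ∞).toLp ρ)).comp (ContinuousLinearMap.fst ℝ _ _)).prod
    (((ContinuousLinearMap.lsmul ℝ ℝ).holderL volume ∞ 2 2
        ((hρ.memLp ∞).toLp ρ)).comp (ContinuousLinearMap.snd ℝ _ _) +
      (((ContinuousLinearMap.lsmul ℝ ℝ).holderL volume (sobExp n) (homDim n) 2).flip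
        ((hρ.memLp_hgrad (homDim n)).toLp (hgrad ρ))).comp (ContinuousLinearMap.fst ℝ _ _))

theorem mulMap_fst {ρ : Heis n → ℝ} (hρ : IsTest ρ) (w : Lp ℝ (sobExp n) (volume : Measure (Heis n)) ×
      Lp (HVec n) 2 (volume : Measure (Heis n))) :
    (mulMap hρ w).1 =ᵐ[volume] fun z => ρ z * w.1 z := by
  filter_upwards [(ContinuousLinearMap.lsmul ℝ ℝ).coeFn_holder (r := sobExp n)
    ((hρ.memLp ∞).toLp ρ) w.1, (hρ.memLp ∞).coeFn_toLp] with z h1 h2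
  rw [h2] at h1
  exact h1

theorem mulMap_snd {ρ : Heis n → ℝ} (hρ : IsTest ρ) (w : Lp ℝ (sobExp n) (volume : Measure (Heis n)) ×
      Lp (HVec n) 2 (volume : Measure (Heis n))) :
    (mulMap hρ w).2 =ᵐ[volume] fun z => ρ z • w.2 z + w.1 z • hgrad ρ z := by
  filter_upwards [(ContinuousLinearMap.lsmul ℝ ℝ).coeFn_holder (r := 2)
      ((hρ.memLp ∞).toLp ρ) w.2, (hρ.memLp ∞).coeFn_toLp,
    (ContinuousLinearMap.lsmul ℝ ℝ).coeFn_holder (r := 2)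
      w.1 ((hρ.memLp_hgrad (homDim n)).toLp (hgrad ρ)),
    (hρ.memLp_hgrad (homDim n)).coeFn_toLp,
    Lp.coeFn_add ((ContinuousLinearMap.lsmul ℝ ℝ).holder 2 ((hρ.memLp ∞).toLp ρ) w.2)
      ((ContinuousLinearMap.lsmul ℝ ℝ).holder 2 w.1
        ((hρ.memLp_hgrad (homDim n)).toLp (hgrad ρ)))] with z h1 h2 h3 h4 h5
  rw [h2] at h1
  rw [h4] at h3
  rw [Pi.add_apply, h1, h3] at h5
  exact h5

theorem mulMap_mem {ρ : Heis n → ℝ} (hρ : IsTest ρ) :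
    ∀ w ∈ (testGraph n).topologicalClosure, mulMap hρ w ∈ (testGraph n).topologicalClosure := by
  intro w hw
  refine map_mem_closure (mulMap hρ).continuous hw ?_
  rintro v ⟨φ, hφ, h1, h2⟩
  refine ⟨ρ * φ, hρ.mul hφ, ?_, ?_⟩
  · filter_upwards [mulMap_fst hρ v, h1] with z a1 a2
    rw [a1, a2, Pi.mul_apply]
  · filter_upwards [mulMap_snd hρ v, h1, h2] with z a1 a2 a3
    rw [a1, a2, a3, hgrad_mul hρ.differentiable hφ.differentiable]

/-- Multiplication by `ρ ∈ C_0^∞(H^n)`, as a linear map of `S_1^2(H^n)` to itself. -/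
def mulTest {ρ : Heis n → ℝ} (hρ : IsTest ρ) : FSSpace n →ₗ[ℝ] FSSpace n :=
  (mulMap hρ).toLinearMap.restrict (mulMap_mem hρ)

end FSSpace

/-! ### Critical points and generalized critical points on a subset of a normed space -/

section Critical

variable {E : Type*} [NormedAddCommGroup E] [NormedSpace ℝ E]

/-- The tangent vectors to `M ⊆ E` at `x`: the velocities at time `0` of the `C^1` curves of `E`
that lie in `M` and pass through `x` at time `0`. -/
def tangentVectors (M : Set E) (x : E) : Set E :=
  {v | ∃ γ : ℝ → E, ContDiffAt ℝ 1 γ 0 ∧ (∀ᶠ t in 𝓝 0, γ t ∈ M) ∧ γ 0 = x ∧ HasDerivAt γ v 0}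

/-- The norm of the derivative of `f|_M` at `x`, i.e. the supremum of `|f'(x) v|` over the tangent
vectors `v` to `M` at `x` with `‖v‖ ≤ 1`. -/
def derivNormOn (f : E → ℝ) (M : Set E) (x : E) : ℝ≥0∞ :=
  ⨆ v ∈ tangentVectors M x, ⨆ _ : ‖v‖ ≤ 1, ‖fderiv ℝ f x v‖ₑ

/-- `x ∈ M` is a critical point of `f` on `M`: the derivative of `f|_M` at `x` vanishes. -/
def IsCriticalOn (f : E → ℝ) (M : Set E) (x : E) : Prop :=
  x ∈ M ∧ DifferentiableAt ℝ f x ∧ ∀ v ∈ tangentVectors M x, fderiv ℝ f x v = 0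

/-- `x ∈ M` is a generalized critical point of `f` on `M`, relative to the linear maps `π`: there
is a sequence `x_j` in `M` with `(f|_M)'(x_j) → 0` and `‖π_k (x_j - x)‖ → 0` for each `k`. -/
def IsGeneralizedCriticalOn {ι : Type*} (π : ι → E →ₗ[ℝ] E) (f : E → ℝ) (M : Set E) (x : E) :
    Prop :=
  x ∈ M ∧ ∃ xs : ℕ → E, (∀ j, xs j ∈ M ∧ DifferentiableAt ℝ f (xs j)) ∧
    Tendsto (fun j => derivNormOn f M (xs j)) atTop (𝓝 0) ∧
    ∀ k, Tendsto (fun j => ‖π k (xs j - x)‖) atTop (𝓝 0)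

end Critical

/-! ### The variational problem -/

/-- The set `B_R = {z ∈ H^n | d(z, 0) < R}`, where
`d((x, y, t), 0) = (t² + (|x|² + |y|²)²)^{1/2}`. -/
def gaugeBall (n : ℕ) (R : ℝ) : Set (Heis n) :=
  {z | Real.sqrt (z.2.2 ^ 2 + (∑ i, z.1 i ^ 2 + ∑ i, z.2.1 i ^ 2) ^ 2) < R}

/-- A cutoff function `ρ_k ∈ C_0^∞(B_{k+1})` with `ρ_k = 1` on `B_k`. -/
structure CutoffFun (n k : ℕ) where
  /-- the function `ρ_k` -/
  fn : Heis n → ℝ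
  isTest : IsTest fn
  tsupport_subset : tsupport fn ⊆ gaugeBall n (k + 1)
  eq_one : ∀ z ∈ gaugeBall n k, fn z = 1

namespace FSSpace

variable {n : ℕ} [NeZero n]

/-- The map `π_k u = ρ_k u` on `S_1^2(H^n)`. -/
def cutoffProj {k : ℕ} (ρ : CutoffFun n k) : FSSpace n →ₗ[ℝ] FSSpace n := mulTest ρ.isTest

/-- The functional `I(u) = (1/2) ∫ |∇_H u|²`. -/
def energy (u : FSSpace n) : ℝ := (1 / 2) * ∫ z, ‖u.grad z‖ ^ 2

/-- The constraint set `M` of all `u ∈ S_1^2(H^n)` with `(1/(p+1)) ∫ |u|^{p+1} = 1`. -/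
def constraint (n : ℕ) [NeZero n] (p : ℝ) : Set (FSSpace n) :=
  {u | Integrable (fun z => |u.toFun z| ^ (p + 1)) ∧
    (1 / (p + 1)) * ∫ z, |u.toFun z| ^ (p + 1) = 1}

/-- `u ∈ S_1^2 ∩ L^{p+1}` is a weak solution of `-Δ_H u = |u|^{p-1} u`:
`∫ ∇_H u · ∇_H v = ∫ |u|^{p-1} u v` for all `v ∈ S_1^2 ∩ L^{p+1}`. Both integrands are then
integrable. -/
def IsWeakSolution (p : ℝ) (u : FSSpace n) : Prop :=
  Integrable (fun z => |u.toFun z| ^ (p + 1)) ∧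
    ∀ v : FSSpace n, Integrable (fun z => |v.toFun z| ^ (p + 1)) →
      ∫ z, inner ℝ (u.grad z) (v.grad z) =
        ∫ z, |u.toFun z| ^ (p - 1) * u.toFun z * v.toFun z

end FSSpace

end

/-! Write `D_u(v) = ∫ ∇_H u · ∇_H v` (`dirichlet`) and `F_u(v) = ∫ |u|^{p-1} u v` (`powPairing`).
The goal is the Euler–Lagrange identity `(p + 1) D_u(v) = ‖u‖² F_u(v)` for all `v ∈ S ∩ L^{p+1}`;
both conclusions follow from it.

If `v ∈ S ∩ L^{p+1}` and `F_u(v) = 0`, then renormalizing the line `u + t v` gives a curve in `M`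
with velocity `v` (`mem_tangentVectors`). For test functions `φ, ψ` the vectors `v_j = F_{u_j}(ψ) φ
- F_{u_j}(φ) ψ` are therefore tangent at `u_j`, so the derivative there tends to zero along them.
Convergence of `u_j` near the supports of `φ` and `ψ` is enough to pass to the limit: the Dirichlet
pairing is local, while for the power pairing a Poincaré inequality gives `L²` convergence near the
supports and the constraint bounds `∫ |u_j|^{p+1}`. The result is `F_u(ψ) D_u(φ) = F_u(φ) D_u(ψ)`
(`dirichlet_mul_powPairing_test`), in which the multiplier has been eliminated by
cross-multiplication.

The identity is extended to `S ∩ L^{p+1}` in each argument (`mul_dirichlet_eq_of_test`). On a fixed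
compact set subcriticality makes `F_u` continuous for the `L^{2Q/(Q-2)}` norm; cutoffs with
gradients bounded in `L^Q` then exhaust the group. Taking `ψ = u` fixes the multiplier, because
`F_u(u) = p + 1`.

For criticality, a tangent curve is only known to be differentiable in `S`, where `F_u` need not be
continuous, so the constraint is not differentiated along it. Instead Young's inequality gives `F_u
≤ p + 1` on `M`, so `D_u` restricted to `M` is maximal at `u` and its derivative along every curve
vanishes. For `p > 1` the multiplier is scaled away by homogeneity. -/

noncomputable section

/-! ### The power nonlinearity -/

section SignedPow

/-- The odd power `x ↦ |x|^{p-1} x`. -/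
def signedPow (p x : ℝ) : ℝ := |x| ^ (p - 1) * x

variable {p : ℝ}

theorem abs_signedPow (hp : 1 ≤ p) (x : ℝ) : |signedPow p x| = |x| ^ p := by
  rcases eq_or_ne x 0 with rfl | hx
  · simp [signedPow, Real.zero_rpow (by linarith : p ≠ 0)]
  · have hx' : 0 < |x| := abs_pos.2 hx
    rw [signedPow, abs_mul, abs_of_nonneg (Real.rpow_nonneg (abs_nonneg x) _)]
    conv_lhs => rw [← Real.rpow_one |x|, ← Real.rpow_mul hx'.le]
    rw [← Real.rpow_add hx']
    congr 1; ring

theorem signedPow_mul_self (hp : 1 ≤ p) (x : ℝ) : signedPow p x * x = |x| ^ (p + 1) := by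
  rcases eq_or_ne x 0 with rfl | hx
  · simp [Real.zero_rpow (by linarith : p + 1 ≠ 0)]
  · have hx' : 0 < |x| := abs_pos.2 hx
    rw [signedPow, mul_assoc, ← abs_mul_abs_self x, ← mul_assoc, ← Real.rpow_add_one hx'.ne',
      ← Real.rpow_add_one hx'.ne']
    congr 1; ring

theorem continuous_signedPow (hp : 1 ≤ p) : Continuous (signedPow p) := by
  unfold signedPow
  exact (continuous_abs.rpow_const fun x => Or.inr (by linarith)).mul continuous_id

theorem signedPow_mul (c x : ℝ) (hc : 0 < c) : signedPow p (c * x) = c ^ p * signedPow p x := by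
  rw [signedPow, signedPow, abs_mul, abs_of_pos hc, Real.mul_rpow hc.le (abs_nonneg x)]
  have : c ^ p = c ^ (p - 1) * c := by
    rw [← Real.rpow_add_one hc.ne']; congr 1; ring
  rw [this]; ring

theorem hasDerivAt_abs_rpow_add_one (hp : 1 ≤ p) (x : ℝ) :
    HasDerivAt (fun x : ℝ => |x| ^ (p + 1)) ((p + 1) * signedPow p x) x := by
  have h := hasDerivAt_abs_rpow x (p := p + 1) (by linarith)
  rw [signedPow, ← mul_assoc]
  convert h using 3
  congr 1; ring

/-- Young's inequality with exponents `(p + 1) / p` and `p + 1`. It is an equality at `b = a`, which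
is why the bound `powPairing_le` is attained at `v = u`; it also provides the dominating functions
for the integrals below. -/
theorem abs_signedPow_mul_le (hp : 1 ≤ p) (a b : ℝ) :
    (p + 1) * |signedPow p a * b| ≤ p * |a| ^ (p + 1) + |b| ^ (p + 1) := by
  have hp0 : 0 < p := by linarith
  have h := Real.young_inequality_of_nonneg (a := |a| ^ p) (b := |b|) (p := (p + 1) / p)
    (q := p + 1) (by positivity) (abs_nonneg b) (by
      rw [Real.holderConjugate_iff]
      refine ⟨by rw [lt_div_iff₀ hp0]; linarith, ?_⟩
      field_simp)
  rw [abs_mul, abs_signedPow hp]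
  rw [← Real.rpow_mul (abs_nonneg a), mul_div_cancel₀ _ hp0.ne'] at h
  have e : p * |a| ^ (p + 1) + |b| ^ (p + 1) =
      (p + 1) * (|a| ^ (p + 1) / ((p + 1) / p) + |b| ^ (p + 1) / (p + 1)) := by
    field_simp
  rw [e]
  exact mul_le_mul_of_nonneg_left h (by linarith)

theorem rpow_le_mul_rpow_add_one {ε : ℝ} (hε : 0 < ε) {x : ℝ} (hx : ε⁻¹ ≤ x) :
    x ^ p ≤ ε * x ^ (p + 1) := by
  have hx0 : 0 < x := (inv_pos.2 hε).trans_le hx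
  rw [Real.rpow_add_one hx0.ne']
  have h1 : 1 ≤ ε * x := by
    rw [← mul_inv_cancel₀ hε.ne']; exact mul_le_mul_of_nonneg_left hx hε.le
  have := Real.rpow_nonneg hx0.le p
  nlinarith

/-- Large values cost little because `|x|^p = o(|x|^{p+1})`; bounded values are handled by uniform
continuity. On `M` the `(p+1)`-st powers have fixed integral, so after integration against a test
function the first term is `O(ε)` uniformly, and only local `L¹` convergence is needed for the
second. -/
theorem exists_abs_signedPow_sub_le (hp : 1 ≤ p) {ε : ℝ} (hε : 0 < ε) :
    ∃ C : ℝ, 0 ≤ C ∧ ∀ a b : ℝ, |signedPow p a - signedPow p b| ≤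
      ε * (1 + |a| ^ (p + 1) + |b| ^ (p + 1)) + C * |a - b| := by
  set M : ℝ := max (2 / ε) 1 with hM
  have hM0 : 0 < M := lt_of_lt_of_le one_pos (le_max_right _ _)
  have huc := (isCompact_Icc (a := -M) (b := M)).uniformContinuousOn_of_continuous
    (continuous_signedPow hp).continuousOn
  rw [Metric.uniformContinuousOn_iff] at huc
  obtain ⟨δ, hδ, H⟩ := huc ε hε
  have hmono : ∀ x : ℝ, |x| ≤ M → |signedPow p x| ≤ M ^ p := fun x hx => by
    rw [abs_signedPow hp]; exact Real.rpow_le_rpow (abs_nonneg x) hx (by linarith)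
  have hlarge : ∀ a b : ℝ, |b| ≤ |a| → M < |a| → |signedPow p a| + |signedPow p b| ≤
      ε * |a| ^ (p + 1) := by
    intro a b hba ha
    have h1 : (ε / 2)⁻¹ ≤ |a| := by
      rw [inv_div]; exact (le_max_left _ _).trans ha.le
    have h2 := rpow_le_mul_rpow_add_one (p := p) (half_pos hε) h1
    have h3 : |b| ^ p ≤ |a| ^ p := Real.rpow_le_rpow (abs_nonneg b) hba (by linarith)
    rw [abs_signedPow hp, abs_signedPow hp]
    linarith
  -- When both arguments are at most `M` in absolute value but at distance at least `δ`, the crude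
  -- bound `2 M^p` is absorbed by the linear term.
  refine ⟨2 * M ^ p / δ, by positivity, fun a b => ?_⟩
  have ha0 : 0 ≤ |a| ^ (p + 1) := by positivity
  have hb0 : 0 ≤ |b| ^ (p + 1) := by positivity
  have hC : 0 ≤ 2 * M ^ p / δ * |a - b| := by positivity
  have htri := abs_sub (signedPow p a) (signedPow p b)
  by_cases hbig : M < |a| ∨ M < |b|
  · have : |signedPow p a| + |signedPow p b| ≤ ε * |a| ^ (p + 1) + ε * |b| ^ (p + 1) := by
      rcases le_total |b| |a| with h | h
      · have := hlarge a b h (hbig.elim id fun h' => h'.trans_le h)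
        have := mul_nonneg hε.le hb0
        linarith
      · have := hlarge b a h (hbig.elim (fun h' => h'.trans_le h) id)
        have := mul_nonneg hε.le ha0
        linarith
    nlinarith
  · push Not at hbig
    rcases lt_or_ge (dist a b) δ with hd | hd
    · have := H a (abs_le.1 hbig.1) b (abs_le.1 hbig.2) hd
      rw [Real.dist_eq] at this
      nlinarith [mul_nonneg hε.le ha0, mul_nonneg hε.le hb0]
    · rw [Real.dist_eq] at hd
      have h1 : 2 * M ^ p ≤ 2 * M ^ p / δ * |a - b| := by
        rw [div_mul_eq_mul_div, le_div_iff₀ hδ]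
        exact mul_le_mul_of_nonneg_left hd (by positivity)
      have h2 := hmono a hbig.1
      have h3 := hmono b hbig.2
      nlinarith [mul_nonneg hε.le ha0, mul_nonneg hε.le hb0]

/-! ### Integrals of `(p+1)`-st powers and their derivatives along lines -/

variable {α : Type*} [MeasurableSpace α] {μ : Measure α} {f g : α → ℝ}

theorem integrable_abs_rpow_iff (hp : 1 ≤ p) (hf : AEStronglyMeasurable f μ) :
    Integrable (fun z => |f z| ^ (p + 1)) μ ↔ MemLp f (ENNReal.ofReal (p + 1)) μ := by
  have h := integrable_norm_rpow_iff hf (p := ENNReal.ofReal (p + 1))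
    (by simp; linarith) ENNReal.ofReal_ne_top
  rw [ENNReal.toReal_ofReal (by linarith)] at h
  exact h

theorem MeasureTheory.MemLp.integrable_abs_rpow (hp : 1 ≤ p)
    (hf : MemLp f (ENNReal.ofReal (p + 1)) μ) : Integrable (fun z => |f z| ^ (p + 1)) μ :=
  (integrable_abs_rpow_iff hp hf.1).2 hf

theorem integrable_signedPow_mul (hp : 1 ≤ p) (hf : MemLp f (ENNReal.ofReal (p + 1)) μ)
    (hg : MemLp g (ENNReal.ofReal (p + 1)) μ) :
    Integrable (fun z => signedPow p (f z) * g z) μ := by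
  refine Integrable.mono' (((hf.integrable_abs_rpow hp).const_mul p).add
    (hg.integrable_abs_rpow hp))
    (((continuous_signedPow hp).comp_aestronglyMeasurable hf.1).mul hg.1) (ae_of_all _ fun z => ?_)
  have h := abs_signedPow_mul_le hp (f z) (g z)
  rw [Real.norm_eq_abs]
  refine le_trans ?_ h
  nlinarith [abs_nonneg (signedPow p (f z) * g z)]

/-- Differentiation under the integral sign, with a bound uniform for `t` in a unit ball. Continuity
of the derivative matters because `tangentVectors` asks for `C^1` curves. -/
theorem contDiff_integral_abs_add_mul_rpow (hp : 1 ≤ p)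
    (hf : MemLp f (ENNReal.ofReal (p + 1)) μ) (hg : MemLp g (ENNReal.ofReal (p + 1)) μ) :
    ContDiff ℝ 1 (fun t : ℝ => ∫ z, |f z + t * g z| ^ (p + 1) ∂μ) ∧
      ∀ t, HasDerivAt (fun t : ℝ => ∫ z, |f z + t * g z| ^ (p + 1) ∂μ)
        ((p + 1) * ∫ z, signedPow p (f z + t * g z) * g z ∂μ) t := by
  have hm : ∀ t : ℝ, MemLp (fun z => f z + t * g z) (ENNReal.ofReal (p + 1)) μ := fun t =>
    hf.add (hg.const_mul t)
  have hsm : ∀ t : ℝ, AEStronglyMeasurable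
      (fun z => (p + 1) * (signedPow p (f z + t * g z) * g z)) μ := fun t =>
    (((continuous_signedPow hp).comp_aestronglyMeasurable (hm t).1).mul hg.1).const_mul _
  have hB : ∀ K : ℝ, Integrable (fun z => p * ‖|f z| + K * |g z|‖ ^ (p + 1) + |g z| ^ (p + 1)) μ :=
    fun K => (((hf.abs.add (hg.abs.const_mul K)).integrable_abs_rpow hp).const_mul p).add
      (hg.integrable_abs_rpow hp)
  have hbd : ∀ K t : ℝ, |t| ≤ K → ∀ z, ‖(p + 1) * (signedPow p (f z + t * g z) * g z)‖ ≤
      p * ‖|f z| + K * |g z|‖ ^ (p + 1) + |g z| ^ (p + 1) := by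
    intro K t ht z
    have h := abs_signedPow_mul_le hp (f z + t * g z) (g z)
    rw [norm_mul, Real.norm_eq_abs, Real.norm_eq_abs, abs_of_nonneg (by linarith : 0 ≤ p + 1)]
    refine h.trans (add_le_add_left (mul_le_mul_of_nonneg_left
      (Real.rpow_le_rpow (abs_nonneg _) ?_ (by linarith)) (by linarith)) _)
    have h0 : 0 ≤ |f z| + K * |g z| := by
      have := (abs_nonneg t).trans ht
      positivity
    rw [Real.norm_eq_abs, abs_of_nonneg h0]
    refine (abs_add_le _ _).trans ?_
    rw [abs_mul]
    gcongr
  have hder : ∀ t, HasDerivAt (fun t : ℝ => ∫ z, |f z + t * g z| ^ (p + 1) ∂μ)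
      (∫ z, (p + 1) * (signedPow p (f z + t * g z) * g z) ∂μ) t := by
    intro t
    refine (hasDerivAt_integral_of_dominated_loc_of_deriv_le (Metric.ball_mem_nhds t one_pos)
      (F := fun t z => |f z + t * g z| ^ (p + 1))
      (Eventually.of_forall fun s => ((hm s).integrable_abs_rpow hp).1)
      ((hm t).integrable_abs_rpow hp) (hsm t)
      (bound := fun z => p * ‖|f z| + (|t| + 1) * |g z|‖ ^ (p + 1) + |g z| ^ (p + 1))
      (ae_of_all _ fun z s hs => hbd _ s ?_ z) (hB _) (ae_of_all _ fun z s _ => ?_)).2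
    · rw [Metric.mem_ball, Real.dist_eq] at hs
      have := abs_sub_abs_le_abs_sub s t
      linarith
    · have h1 : HasDerivAt (fun s : ℝ => f z + s * g z) (g z) s := by
        simpa using ((hasDerivAt_id s).mul_const (g z)).const_add (f z)
      have h2 := (hasDerivAt_abs_rpow_add_one hp (f z + s * g z)).comp s h1
      rw [mul_assoc] at h2
      exact h2
  refine ⟨contDiff_one_iff_deriv.2 ⟨fun t => (hder t).differentiableAt, ?_⟩, fun t => ?_⟩
  · have : deriv (fun t : ℝ => ∫ z, |f z + t * g z| ^ (p + 1) ∂μ) =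
        fun t => ∫ z, (p + 1) * (signedPow p (f z + t * g z) * g z) ∂μ :=
      funext fun t => (hder t).deriv
    rw [this, continuous_iff_continuousAt]
    intro t
    refine continuousAt_of_dominated
      (bound := fun z => p * ‖|f z| + (|t| + 1) * |g z|‖ ^ (p + 1) + |g z| ^ (p + 1))
      (Eventually.of_forall hsm) ?_ (hB _) (ae_of_all _ fun z => ?_)
    · filter_upwards [Metric.ball_mem_nhds t one_pos] with s hs
      refine ae_of_all _ fun z => hbd _ s ?_ z
      rw [Metric.mem_ball, Real.dist_eq] at hs
      have := abs_sub_abs_le_abs_sub s t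
      linarith
    · exact (continuous_const.mul (((continuous_signedPow hp).comp (by fun_prop)).mul
        continuous_const)).continuousAt
  · rw [← integral_const_mul]
    exact hder t

end SignedPow

namespace FSSpace

variable {n : ℕ} [NeZero n] {p : ℝ}

/-! ### Energy and constraint -/

theorem norm_eq_norm_grad (u : FSSpace n) : ‖u‖ = ‖u.grad‖ := rfl

theorem toFun_add (u v : FSSpace n) : (u + v).toFun = u.toFun + v.toFun := rfl

theorem toFun_sub (u v : FSSpace n) : (u - v).toFun = u.toFun - v.toFun := rfl

theorem toFun_smul (c : ℝ) (u : FSSpace n) : (c • u).toFun = c • u.toFun := rfl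

/-- The gradient as an isometric embedding into `L²`. -/
def gradₗᵢ : FSSpace n →ₗᵢ[ℝ] Lp (HVec n) 2 (volume : Measure (Heis n)) :=
  ⟨grad, fun _ => rfl⟩

theorem gradₗᵢ_apply (u : FSSpace n) : gradₗᵢ u = u.grad := rfl

/-- The Dirichlet pairing `∫ ∇_H u · ∇_H v` as a continuous linear functional of `v`. -/
def dirichlet (u : FSSpace n) : FSSpace n →L[ℝ] ℝ :=
  (innerSL ℝ u.grad).comp gradₗᵢ.toContinuousLinearMap

theorem dirichlet_eq_integral (u v : FSSpace n) :
    dirichlet u v = ∫ z, inner ℝ (u.grad z) (v.grad z) := L2.inner_def _ _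

theorem dirichlet_comm (u v : FSSpace n) : dirichlet u v = dirichlet v u :=
  real_inner_comm v.grad u.grad

theorem dirichlet_self (u : FSSpace n) : dirichlet u u = ‖u‖ ^ 2 :=
  real_inner_self_eq_norm_sq u.grad

theorem energy_eq (u : FSSpace n) : energy u = (1 / 2) * ‖gradₗᵢ u‖ ^ 2 := by
  rw [← real_inner_self_eq_norm_sq, gradₗᵢ_apply, L2.inner_def, energy]
  simp only [real_inner_self_eq_norm_sq]

theorem hasFDerivAt_energy (u : FSSpace n) : HasFDerivAt energy (dirichlet u) u := by
  have h1 : HasFDerivAt (fun u : FSSpace n => gradₗᵢ u) gradₗᵢ.toContinuousLinearMap u :=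
    gradₗᵢ.toContinuousLinearMap.hasFDerivAt
  have h2 := (h1.norm_sq).const_mul (1 / 2 : ℝ)
  rw [funext energy_eq]
  refine h2.congr_fderiv ?_
  ext v
  change (1 / 2 : ℝ) * ((2 : ℕ) • inner ℝ u.grad v.grad) = inner ℝ u.grad v.grad
  rw [nsmul_eq_mul]
  push_cast
  ring

theorem fderiv_energy (u : FSSpace n) : fderiv ℝ energy u = dirichlet u :=
  (hasFDerivAt_energy u).fderiv

/-- The pairing `∫ |u|^{p-1} u v`. -/
def powPairing (p : ℝ) (u v : FSSpace n) : ℝ := ∫ z, signedPow p (u.toFun z) * v.toFun z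

/-- Membership in `L^{p+1}`. -/
def MemPow (p : ℝ) (u : FSSpace n) : Prop :=
  MemLp u.toFun (ENNReal.ofReal (p + 1)) (volume : Measure (Heis n))

theorem memPow_iff (hp : 1 ≤ p) (u : FSSpace n) :
    MemPow p u ↔ Integrable (fun z => |u.toFun z| ^ (p + 1)) :=
  (integrable_abs_rpow_iff hp (Lp.aestronglyMeasurable _)).symm

theorem MemPow.add {u v : FSSpace n} (hu : MemPow p u) (hv : MemPow p v) : MemPow p (u + v) := by
  rw [MemPow, toFun_add]
  exact (MemLp.add hu hv).ae_eq (Lp.coeFn_add _ _).symm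

theorem MemPow.smul {u : FSSpace n} (hu : MemPow p u) (c : ℝ) : MemPow p (c • u) := by
  rw [MemPow, toFun_smul]
  exact (MemLp.const_smul hu c).ae_eq (Lp.coeFn_smul _ _).symm

theorem powPairing_add (hp : 1 ≤ p) {u v w : FSSpace n} (hu : MemPow p u) (hv : MemPow p v)
    (hw : MemPow p w) : powPairing p u (v + w) = powPairing p u v + powPairing p u w := by
  rw [powPairing, powPairing, powPairing,
    ← integral_add (integrable_signedPow_mul hp hu hv) (integrable_signedPow_mul hp hu hw)]
  refine integral_congr_ae ?_
  rw [toFun_add]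
  filter_upwards [Lp.coeFn_add v.toFun w.toFun] with z hz
  rw [hz, Pi.add_apply, mul_add]

theorem powPairing_smul (u v : FSSpace n) (c : ℝ) :
    powPairing p u (c • v) = c * powPairing p u v := by
  rw [powPairing, powPairing, ← integral_const_mul]
  refine integral_congr_ae ?_
  rw [toFun_smul]
  filter_upwards [Lp.coeFn_smul c v.toFun] with z hz
  rw [hz, Pi.smul_apply, smul_eq_mul]
  ring

theorem mem_constraint_iff (hp : 1 ≤ p) (u : FSSpace n) :
    u ∈ constraint n p ↔ MemPow p u ∧ ∫ z, |u.toFun z| ^ (p + 1) = p + 1 := by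
  rw [memPow_iff hp]
  refine and_congr_right fun _ => ?_
  have : p + 1 ≠ 0 := by linarith
  rw [one_div, inv_mul_eq_iff_eq_mul₀ this, mul_one]

theorem powPairing_self (hp : 1 ≤ p) {u : FSSpace n} (hu : u ∈ constraint n p) :
    powPairing p u u = p + 1 := by
  rw [← ((mem_constraint_iff hp u).1 hu).2, powPairing]
  simp only [signedPow_mul_self hp]

/-- Elements of `M` maximize `v ↦ ∫ |u|^{p-1} u v` over `M` at `v = u`. -/
theorem powPairing_le (hp : 1 ≤ p) {u v : FSSpace n} (hu : u ∈ constraint n p)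
    (hv : v ∈ constraint n p) : powPairing p u v ≤ p + 1 := by
  rw [mem_constraint_iff hp] at hu hv
  have h0 : 0 < p + 1 := by linarith
  have iu := MemLp.integrable_abs_rpow hp hu.1
  have iv := MemLp.integrable_abs_rpow hp hv.1
  have h : ∫ z, (p + 1) * (signedPow p (u.toFun z) * v.toFun z) ≤
      ∫ z, (p * |u.toFun z| ^ (p + 1) + |v.toFun z| ^ (p + 1)) := by
    refine integral_mono ((integrable_signedPow_mul hp hu.1 hv.1).const_mul _)
      ((iu.const_mul p).add iv) fun z => ?_
    exact (mul_le_mul_of_nonneg_left (le_abs_self _) h0.le).trans (abs_signedPow_mul_le hp _ _)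
  -- The right side becomes `p (p + 1) + (p + 1) = (p + 1)²`.
  rw [integral_const_mul, integral_add (iu.const_mul p) iv, integral_const_mul, hu.2, hv.2] at h
  rw [powPairing]
  nlinarith

/-- The kernel of `v ↦ ∫ |u|^{p-1} u v` consists of tangent vectors to `M` at `u`. -/
theorem mem_tangentVectors (hp : 1 ≤ p) {u v : FSSpace n} (hu : u ∈ constraint n p)
    (hv : MemPow p v) (huv : powPairing p u v = 0) : v ∈ tangentVectors (constraint n p) u := by
  have hu' := (mem_constraint_iff hp u).1 hu
  have h0 : 0 < p + 1 := by linarith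
  set h : ℝ → ℝ := fun t => ∫ z, |u.toFun z + t * v.toFun z| ^ (p + 1) with hh
  obtain ⟨hC, hD⟩ := contDiff_integral_abs_add_mul_rpow hp hu'.1 hv
  have hh0 : h 0 = p + 1 := by simpa [hh] using hu'.2
  have hD0 : HasDerivAt h 0 0 := by
    have := hD 0
    simp only [zero_mul, add_zero] at this
    have e : ∫ z, signedPow p (u.toFun z) * v.toFun z = 0 := huv
    rwa [e, mul_zero] at this
  -- The factor that puts `a t • (u + t • v)` back on `M`. Since `h` is stationary at `0`, so is
  -- `a`, and the renormalization leaves the velocity `v` unchanged.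
  set a : ℝ → ℝ := fun t => (h t / (p + 1)) ^ (-(1 / (p + 1))) with ha
  have hq0 : h 0 / (p + 1) = 1 := by rw [hh0, div_self h0.ne']
  have ha0 : a 0 = 1 := by simp only [ha, hq0, Real.one_rpow]
  have haC : ContDiffAt ℝ 1 a 0 :=
    (hC.contDiffAt.div_const _).rpow_const_of_ne (by rw [hq0]; exact one_ne_zero)
  have haD : HasDerivAt a 0 0 := by
    have := (hD0.div_const (p + 1)).rpow_const (p := -(1 / (p + 1)))
      (Or.inl (by rw [hq0]; exact one_ne_zero))
    simpa only [zero_div, zero_mul] using this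
  have hlin : HasDerivAt (fun t : ℝ => u + t • v) v 0 := by
    simpa using ((hasDerivAt_id (0 : ℝ)).smul_const v).const_add u
  refine ⟨fun t => a t • (u + t • v), haC.smul (by fun_prop), ?_, by simp [ha0], ?_⟩
  · have hpos : ∀ᶠ t in 𝓝 (0 : ℝ), 0 < h t :=
      hC.continuous.continuousAt.eventually (lt_mem_nhds (by
        change 0 < h 0
        rw [hh0]; exact h0))
    filter_upwards [hpos] with t ht
    have hat : 0 < a t := Real.rpow_pos_of_pos (by positivity) _
    rw [mem_constraint_iff hp]
    refine ⟨(hu'.1.add (hv.smul t)).smul _, ?_⟩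
    have e1 : ∫ z, |(a t • (u + t • v)).toFun z| ^ (p + 1) = ∫ z, a t ^ (p + 1) *
        |u.toFun z + t * v.toFun z| ^ (p + 1) := by
      refine integral_congr_ae ?_
      rw [toFun_smul, toFun_add, toFun_smul]
      filter_upwards [Lp.coeFn_smul (a t) (u.toFun + t • v.toFun),
        Lp.coeFn_add u.toFun (t • v.toFun), Lp.coeFn_smul t v.toFun] with z h1 h2 h3
      rw [h1, Pi.smul_apply, h2, Pi.add_apply, h3, Pi.smul_apply, smul_eq_mul, smul_eq_mul,
        abs_mul, abs_of_pos hat, Real.mul_rpow hat.le (abs_nonneg _)]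
    rw [e1, integral_const_mul]
    change a t ^ (p + 1) * h t = p + 1
    have e2 : a t ^ (p + 1) = (h t / (p + 1))⁻¹ := by
      rw [ha, ← Real.rpow_mul (by positivity), ← Real.rpow_neg_one]
      congr 1
      field_simp
    rw [e2]
    field_simp
  · have := haD.smul hlin
    simp only [zero_smul, add_zero, ha0, one_smul] at this
    exact this

/-! ### Test functions as elements of `S_1^2` -/

/-- A test function as an element of `S_1^2(H^n)`. -/
def ofTest {φ : Heis n → ℝ} (hφ : IsTest φ) : FSSpace n :=
  ⟨((hφ.memLp _).toLp φ, (hφ.memLp_hgrad _).toLp (hgrad φ)), subset_closure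
    ⟨φ, hφ, (hφ.memLp _).coeFn_toLp, (hφ.memLp_hgrad _).coeFn_toLp⟩⟩

theorem toFun_ofTest {φ : Heis n → ℝ} (hφ : IsTest φ) : (ofTest hφ).toFun =ᵐ[volume] φ :=
  (hφ.memLp _).coeFn_toLp

theorem grad_ofTest {φ : Heis n → ℝ} (hφ : IsTest φ) : (ofTest hφ).grad =ᵐ[volume] hgrad φ :=
  (hφ.memLp_hgrad _).coeFn_toLp

theorem memPow_ofTest {φ : Heis n → ℝ} (hφ : IsTest φ) : MemPow p (ofTest hφ) :=
  (hφ.memLp _).ae_eq (toFun_ofTest hφ).symm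

theorem toFun_mulTest {ρ : Heis n → ℝ} (hρ : IsTest ρ) (u : FSSpace n) :
    (mulTest hρ u).toFun =ᵐ[volume] fun z => ρ z * u.toFun z := mulMap_fst hρ u.1

theorem grad_mulTest {ρ : Heis n → ℝ} (hρ : IsTest ρ) (u : FSSpace n) :
    (mulTest hρ u).grad =ᵐ[volume] fun z => ρ z • u.grad z + u.toFun z • hgrad ρ z :=
  mulMap_snd hρ u.1

theorem ext_toFun_grad {u v : FSSpace n} (h1 : u.toFun = v.toFun) (h2 : u.grad = v.grad) : u = v :=
  Subtype.ext (Prod.ext h1 h2)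

theorem mulTest_ofTest {ρ φ : Heis n → ℝ} (hρ : IsTest ρ) (hφ : IsTest φ) :
    mulTest hρ (ofTest hφ) = ofTest (hρ.mul hφ) := by
  refine ext_toFun_grad (Lp.ext ?_) (Lp.ext ?_)
  · filter_upwards [toFun_mulTest hρ (ofTest hφ), toFun_ofTest hφ, toFun_ofTest (hρ.mul hφ)]
      with z h1 h2 h3
    rw [h1, h2, h3, Pi.mul_apply]
  · filter_upwards [grad_mulTest hρ (ofTest hφ), toFun_ofTest hφ, grad_ofTest hφ,
      grad_ofTest (hρ.mul hφ)] with z h1 h2 h3 h4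
    rw [h1, h2, h3, h4, hgrad_mul hρ.differentiable hφ.differentiable]

/-- Every element of `S_1^2(H^n)` is the limit of test functions, with convergence of the functions
in `L^{2Q/(Q-2)}` and of the gradients in `L²`. -/
theorem exists_seq_ofTest (u : FSSpace n) : ∃ (φ : ℕ → Heis n → ℝ) (hφ : ∀ m, IsTest (φ m)),
    Tendsto (fun m => (ofTest (hφ m)).1) atTop (𝓝 u.1) := by
  obtain ⟨v, hv, hlim⟩ := mem_closure_iff_seq_limit.1
    (show u.1 ∈ closure ((testGraph n : Submodule ℝ _) : Set _) from u.2)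
  choose φ hφ hφ1 hφ2 using hv
  refine ⟨φ, hφ, ?_⟩
  convert hlim using 2 with m
  exact Prod.ext (Lp.ext ((toFun_ofTest (hφ m)).trans (hφ1 m).symm))
    (Lp.ext ((grad_ofTest (hφ m)).trans (hφ2 m).symm))

/-- The norm of `S` sees only the gradient component, so convergence of pairs is formally the
stronger notion; no Folland–Stein inequality is used. -/
theorem tendsto_of_tendsto_val {ι : Type*} {l : Filter ι} {v : ι → FSSpace n} {u : FSSpace n}
    (h : Tendsto (fun m => (v m).1) l (𝓝 u.1)) : Tendsto v l (𝓝 u) := by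
  rw [gradₗᵢ.isometry.isEmbedding.isInducing.tendsto_nhds_iff]
  exact (continuous_snd.tendsto u.1).comp h

end FSSpace

/-! ### Poincaré inequality and limits on compact sets -/

/-- Poincaré inequality for test functions supported in a slab `|x_i| ≤ R`. -/
theorem IsTest.eLpNorm_le_of_support {n : ℕ} (i : Fin n) {φ : Heis n → ℝ} (hφ : IsTest φ) {R : ℝ}
    (hR : 0 ≤ R) (hs : ∀ z, φ z ≠ 0 → |z.1 i| ≤ R) :
    eLpNorm φ 2 volume ≤ ENNReal.ofReal (2 * R + 1) * eLpNorm (hgrad φ) 2 volume := by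
  have key : ∫⁻ z, ‖φ z‖ₑ ^ (2 : ℝ) ≤
      ENNReal.ofReal (2 * R + 1) ^ (2 : ℝ) * ∫⁻ z, ‖hgrad φ z‖ₑ ^ (2 : ℝ) := by
    -- A shift by `2 R + 1 > 2 R` along `X_i` moves the slab off itself, so wherever `φ` is nonzero
    -- its translate vanishes and the difference quotient estimate controls `φ`.
    refine le_trans (lintegral_mono fun z => ?_)
      (lintegral_flowX_sub_le i hφ (s := 2 * R + 1) (by linarith))
    refine ENNReal.rpow_le_rpow ?_ (by norm_num)
    by_cases hz : φ z = 0
    · simp [hz]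
    · have h1 := hs z hz
      have h2 : φ (flowX i (2 * R + 1) z) = 0 := by
        by_contra hne
        have h3 := hs _ hne
        have : (flowX i (2 * R + 1) z).1 i = z.1 i + (2 * R + 1) := by simp [flowX, vecX]
        rw [this] at h3
        rw [abs_le] at h1 h3
        linarith
      rw [h2, zero_sub, enorm_neg]
  rw [eLpNorm_eq_lintegral_rpow_enorm_toReal (by norm_num) (by norm_num),
    eLpNorm_eq_lintegral_rpow_enorm_toReal (by norm_num) (by norm_num)]
  simp only [ENNReal.toReal_ofNat]
  refine (ENNReal.rpow_le_rpow key (by norm_num)).trans ?_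
  rw [ENNReal.mul_rpow_of_nonneg _ _ (by norm_num), ← ENNReal.rpow_mul]
  norm_num

namespace FSSpace

variable {n : ℕ} [NeZero n] {p : ℝ}

/-- Poincaré inequality for the elements `ρ u` of `S_1^2(H^n)`, where `ρ ∈ C_0^∞`. -/
theorem exists_eLpNorm_mulTest_le {ρ : Heis n → ℝ} (hρ : IsTest ρ) :
    ∃ C : ℝ, ∀ u : FSSpace n, eLpNorm (mulTest hρ u).toFun 2 volume ≤
      ENNReal.ofReal (C * ‖mulTest hρ u‖) := by
  let i : Fin n := ⟨0, Nat.pos_of_ne_zero (NeZero.ne n)⟩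
  obtain ⟨R, hR⟩ : ∃ R : ℝ, ∀ z ∈ tsupport ρ, ‖z.1 i‖ ≤ R :=
    IsCompact.exists_bound_of_continuousOn hρ.2 (by fun_prop)
  -- The `max` covers an empty support, for which `R` may be negative.
  set C : ℝ := 2 * max R 0 + 1 with hC
  have hC0 : 0 ≤ C := by positivity
  have htest : ∀ {φ : Heis n → ℝ} (hφ : IsTest φ),
      eLpNorm (mulTest hρ (ofTest hφ)).toFun 2 volume ≤
        ENNReal.ofReal (C * ‖mulTest hρ (ofTest hφ)‖) := by
    intro φ hφ
    have h := (hρ.mul hφ).eLpNorm_le_of_support i (le_max_right R 0) (fun z hz =>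
      (hR z (subset_tsupport _ (left_ne_zero_of_mul hz))).trans (le_max_left R 0))
    rw [← hC] at h
    rw [mulTest_ofTest, eLpNorm_congr_ae (toFun_ofTest _)]
    refine h.trans_eq ?_
    rw [ENNReal.ofReal_mul hC0, norm_eq_norm_grad, ofReal_norm, Lp.enorm_def,
      eLpNorm_congr_ae (grad_ofTest _)]
  refine ⟨C, fun u => ?_⟩
  obtain ⟨φ, hφ, hlim⟩ := exists_seq_ofTest u
  have hlim' : Tendsto (fun m => (mulTest hρ (ofTest (hφ m))).1) atTop (𝓝 (mulTest hρ u).1) :=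
    ((mulMap hρ).continuous.tendsto u.1).comp hlim
  have hn : Tendsto (fun m => ENNReal.ofReal (C * ‖mulTest hρ (ofTest (hφ m))‖)) atTop
      (𝓝 (ENNReal.ofReal (C * ‖mulTest hρ u‖))) :=
    ENNReal.tendsto_ofReal ((tendsto_of_tendsto_val hlim').norm.const_mul C)
  -- The `L²` norm of the function is not yet known to be continuous along the approximation, so the
  -- bound passes to the limit by Fatou along an almost everywhere convergent subsequence.
  have hmeas := tendstoInMeasure_of_tendsto_Lp ((continuous_fst.tendsto _).comp hlim')
  obtain ⟨ns, hns, hae⟩ := hmeas.exists_seq_tendsto_ae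
  refine (Lp.eLpNorm_lim_le_liminf_eLpNorm (p := 2)
    (f := fun m => ((mulTest hρ (ofTest (hφ (ns m)))).toFun : Heis n → ℝ))
    (fun m => Lp.aestronglyMeasurable _) _ hae).trans ?_
  refine (liminf_le_liminf (Eventually.of_forall fun m => htest (hφ (ns m)))).trans ?_
  exact (hn.comp hns.tendsto_atTop).liminf_eq.le

/-- Since `ρ = 1` where `φ ≠ 0`, the difference may be multiplied by `ρ`; Cauchy–Schwarz and the
Poincaré inequality for `ρ (u_j - u)` then suffice. -/
theorem tendsto_integral_abs_mul_of_tendsto_mulTest {ρ φ : Heis n → ℝ} (hρ : IsTest ρ)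
    (hφ : IsTest φ) (hρφ : ∀ z, φ z ≠ 0 → ρ z = 1) {us : ℕ → FSSpace n} {u : FSSpace n}
    (h : Tendsto (fun j => ‖mulTest hρ (us j - u)‖) atTop (𝓝 0)) :
    (∀ j, Integrable (fun z => |φ z| * |(us j).toFun z - u.toFun z|)) ∧
    Tendsto (fun j => ∫ z, |φ z| * |(us j).toFun z - u.toFun z|) atTop (𝓝 0) := by
  obtain ⟨C, hC⟩ := exists_eLpNorm_mulTest_le (n := n) hρ
  have hae : ∀ j, (fun z => |φ z| * |(us j).toFun z - u.toFun z|) =ᵐ[volume]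
      fun z => ‖(φ • ((mulTest hρ (us j - u)).toFun : Heis n → ℝ)) z‖ := by
    intro j
    filter_upwards [toFun_mulTest hρ (us j - u), Lp.coeFn_sub (us j).toFun u.toFun] with z h1 h2
    rw [Pi.smul_apply', h1, toFun_sub, h2, Pi.sub_apply, smul_eq_mul, Real.norm_eq_abs, abs_mul]
    by_cases hz : φ z = 0
    · simp [hz]
    · rw [hρφ z hz, one_mul]
  have hle : ∀ j, eLpNorm (φ • ((mulTest hρ (us j - u)).toFun : Heis n → ℝ)) 1 volume ≤
      eLpNorm φ 2 volume * ENNReal.ofReal (C * ‖mulTest hρ (us j - u)‖) := fun j =>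
    (eLpNorm_smul_le_mul_eLpNorm (p := 2) (q := 2) (r := 1) (Lp.aestronglyMeasurable _)
      (hφ.memLp 2).1).trans (mul_le_mul_right (hC _) _)
  have hlim : Tendsto (fun j => eLpNorm φ 2 volume *
      ENNReal.ofReal (C * ‖mulTest hρ (us j - u)‖)) atTop (𝓝 0) := by
    have := ENNReal.Tendsto.const_mul (a := eLpNorm φ 2 volume)
      (ENNReal.tendsto_ofReal (h.const_mul C)) (Or.inr (hφ.memLp 2).eLpNorm_ne_top)
    simpa using this
  have hInt : ∀ j, Integrable (φ • ((mulTest hρ (us j - u)).toFun : Heis n → ℝ)) := fun j =>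
    memLp_one_iff_integrable.1 ⟨(hφ.memLp 2).1.smul (Lp.aestronglyMeasurable _),
      (hle j).trans_lt (ENNReal.mul_lt_top (hφ.memLp 2).2 ENNReal.ofReal_lt_top)⟩
  refine ⟨fun j => (hInt j).norm.congr (hae j).symm, ?_⟩
  have e : ∀ j, ∫ z, |φ z| * |(us j).toFun z - u.toFun z| =
      (eLpNorm (φ • ((mulTest hρ (us j - u)).toFun : Heis n → ℝ)) 1 volume).toReal := fun j => by
    rw [integral_congr_ae (hae j), integral_norm_eq_lintegral_enorm (hInt j).1,
      eLpNorm_one_eq_lintegral_enorm]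
  simp only [e]
  have := tendsto_of_tendsto_of_tendsto_of_le_of_le tendsto_const_nhds hlim
    (fun _ => zero_le) hle
  exact (ENNReal.tendsto_toReal ENNReal.zero_ne_top).comp this

theorem tendsto_powPairing_of_tendsto_mulTest (hp : 1 ≤ p) {ρ φ : Heis n → ℝ} (hρ : IsTest ρ)
    (hφ : IsTest φ) (hρφ : ∀ z, φ z ≠ 0 → ρ z = 1) {us : ℕ → FSSpace n} {u : FSSpace n}
    (hu : u ∈ constraint n p) (hus : ∀ j, us j ∈ constraint n p)
    (h : Tendsto (fun j => ‖mulTest hρ (us j - u)‖) atTop (𝓝 0)) :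
    Tendsto (fun j => powPairing p (us j) (ofTest hφ)) atTop (𝓝 (powPairing p u (ofTest hφ))) := by
  obtain ⟨hInt, hlim⟩ := tendsto_integral_abs_mul_of_tendsto_mulTest hρ hφ hρφ h
  obtain ⟨B, hB⟩ := hφ.2.exists_bound_of_continuous hφ.1.continuous
  have hB0 : 0 ≤ B := (norm_nonneg _).trans (hB 0)
  rw [mem_constraint_iff hp] at hu
  simp only [mem_constraint_iff hp] at hus
  have h0 : 0 < p + 1 := by linarith
  have hφi : Integrable (fun z => |φ z|) := (memLp_one_iff_integrable.1 (hφ.memLp 1)).abs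
  -- A bound, uniform in `j`, for `∫ |φ| (1 + |u_j|^{p+1} + |u|^{p+1})`, as both power integrals
  -- equal `p + 1` on `M`. No bound on `u_j` in `S` enters.
  set A : ℝ := (∫ z, |φ z|) + B * (p + 1) + B * (p + 1) with hA
  have hA0 : 0 ≤ A := by
    have : 0 ≤ ∫ z, |φ z| := integral_nonneg fun z => abs_nonneg _
    positivity
  have key : ∀ ε > 0, ∃ C : ℝ, 0 ≤ C ∧ ∀ j, |powPairing p (us j) (ofTest hφ) -
      powPairing p u (ofTest hφ)| ≤ ε * A + C * ∫ z, |φ z| * |(us j).toFun z - u.toFun z| := by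
    intro ε hε
    obtain ⟨C, hC, H⟩ := exists_abs_signedPow_sub_le hp hε
    refine ⟨C, hC, fun j => ?_⟩
    have i1 := MemLp.integrable_abs_rpow hp (hus j).1
    have i2 := MemLp.integrable_abs_rpow hp hu.1
    have iR : Integrable (fun z => ε * (|φ z| + B * |(us j).toFun z| ^ (p + 1) +
        B * |u.toFun z| ^ (p + 1)) + C * (|φ z| * |(us j).toFun z - u.toFun z|)) :=
      (((hφi.add (i1.const_mul B)).add (i2.const_mul B)).const_mul ε).add ((hInt j).const_mul C)
    rw [powPairing, powPairing, ← integral_sub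
      (integrable_signedPow_mul hp (hus j).1 (memPow_ofTest hφ))
      (integrable_signedPow_mul hp hu.1 (memPow_ofTest hφ)), ← Real.norm_eq_abs]
    refine (norm_integral_le_of_norm_le iR ?_).trans_eq ?_
    · filter_upwards [toFun_ofTest hφ] with z hz
      rw [hz, ← sub_mul, norm_mul, Real.norm_eq_abs, Real.norm_eq_abs]
      have h1 := mul_le_mul_of_nonneg_right (H ((us j).toFun z) (u.toFun z)) (abs_nonneg (φ z))
      have h2 : |φ z| ≤ B := hB z
      have h3 : 0 ≤ |(us j).toFun z| ^ (p + 1) := by positivity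
      have h4 : 0 ≤ |u.toFun z| ^ (p + 1) := by positivity
      have h5 := mul_le_mul_of_nonneg_left (add_le_add (mul_le_mul_of_nonneg_right h2 h3)
        (mul_le_mul_of_nonneg_right h2 h4)) hε.le
      linarith
    · have j1 : Integrable (fun z => |φ z| + B * |(us j).toFun z| ^ (p + 1)) :=
        hφi.add (i1.const_mul B)
      have j2 : Integrable (fun z => |φ z| + B * |(us j).toFun z| ^ (p + 1) +
          B * |u.toFun z| ^ (p + 1)) := j1.add (i2.const_mul B)
      rw [integral_add (j2.const_mul ε) ((hInt j).const_mul C), integral_const_mul,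
        integral_const_mul, integral_add j1 (i2.const_mul B),
        integral_add hφi (i1.const_mul B), integral_const_mul, integral_const_mul, (hus j).2, hu.2]
  rw [Metric.tendsto_atTop]
  intro ε hε
  obtain ⟨C, hC, H⟩ := key (ε / (2 * (A + 1))) (by positivity)
  have hCl := hlim.const_mul C
  rw [mul_zero] at hCl
  obtain ⟨N, hN⟩ := eventually_atTop.1 (hCl.eventually (gt_mem_nhds (half_pos hε)))
  refine ⟨N, fun j hj => ?_⟩
  rw [Real.dist_eq]
  have h1 := H j
  have h2 := hN j hj
  have h3 : ε / (2 * (A + 1)) * A ≤ ε / 2 := by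
    rw [div_mul_eq_mul_div, div_le_div_iff₀ (by positivity) two_pos]
    nlinarith
  linarith

/-- The pairing with `φ` only sees the gradient on the support of `φ`. There `ρ` must equal `1` on a
neighbourhood, not just pointwise, so that the term with `∇_H ρ` drops out. -/
theorem tendsto_dirichlet_of_tendsto_mulTest {ρ φ : Heis n → ℝ} (hρ : IsTest ρ)
    (hφ : IsTest φ) (hρφ : ∀ z ∈ tsupport φ, ρ =ᶠ[𝓝 z] 1) {us : ℕ → FSSpace n} {u : FSSpace n}
    (h : Tendsto (fun j => ‖mulTest hρ (us j - u)‖) atTop (𝓝 0)) :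
    Tendsto (fun j => dirichlet (us j) (ofTest hφ)) atTop (𝓝 (dirichlet u (ofTest hφ))) := by
  have e : ∀ w : FSSpace n, dirichlet (mulTest hρ w) (ofTest hφ) = dirichlet w (ofTest hφ) := by
    intro w
    rw [dirichlet_eq_integral, dirichlet_eq_integral]
    refine integral_congr_ae ?_
    filter_upwards [grad_mulTest hρ w, grad_ofTest hφ] with z h1 h2
    rw [h1, h2]
    by_cases hz : z ∈ tsupport φ
    · have h3 : hgrad ρ z = 0 := by
        have : fderiv ℝ ρ z = 0 := by
          rw [(hρφ z hz).fderiv_eq]; simp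
        ext i
        rcases i with i | i <;> simp [hgrad, this]
      rw [(hρφ z hz).eq_of_nhds, h3]
      simp
    · have h3 : hgrad φ z = 0 := by
        have : fderiv ℝ φ z = 0 := by
          have := notMem_tsupport_iff_eventuallyEq.1 hz
          rw [this.fderiv_eq]; simp
        ext i
        rcases i with i | i <;> simp [hgrad, this]
      rw [h3]
      simp
  have hz : Tendsto (fun j => mulTest hρ (us j - u)) atTop (𝓝 0) :=
    tendsto_zero_iff_norm_tendsto_zero.2 h
  have h1 := ((dirichlet (ofTest hφ)).continuous.tendsto 0).comp hz
  rw [map_zero] at h1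
  have h2 : Tendsto (fun j => dirichlet (us j) (ofTest hφ) - dirichlet u (ofTest hφ)) atTop
      (𝓝 0) := by
    refine h1.congr fun j => ?_
    rw [Function.comp, dirichlet_comm, e, dirichlet_comm, map_sub, dirichlet_comm _ (us j),
      dirichlet_comm _ u]
  have := h2.add_const (dirichlet u (ofTest hφ))
  simpa using this

end FSSpace

/-! ### Rescaled cutoff functions -/

/-- The Heisenberg dilation `(x, y, t) ↦ (s x, s y, s² t)`. -/
def dilation (n : ℕ) (s : ℝ) : Heis n →L[ℝ] Heis n :=
  (s • ContinuousLinearMap.id ℝ (Fin n → ℝ)).prodMap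
    ((s • ContinuousLinearMap.id ℝ (Fin n → ℝ)).prodMap (s ^ 2 • ContinuousLinearMap.id ℝ ℝ))

theorem dilation_apply {n : ℕ} (s : ℝ) (z : Heis n) :
    dilation n s z = (s • z.1, s • z.2.1, s ^ 2 * z.2.2) := rfl

theorem det_dilation (n : ℕ) (s : ℝ) :
    LinearMap.det (dilation n s : Heis n →ₗ[ℝ] Heis n) = s ^ homDim n := by
  have : (dilation n s : Heis n →ₗ[ℝ] Heis n) = (s • LinearMap.id (R := ℝ) (M := Fin n → ℝ)).prodMap
      ((s • LinearMap.id (R := ℝ) (M := Fin n → ℝ)).prodMap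
        (s ^ 2 • LinearMap.id (R := ℝ) (M := ℝ))) := rfl
  rw [this, LinearMap.det_prodMap, LinearMap.det_prodMap, LinearMap.det_smul, LinearMap.det_smul]
  simp [homDim]
  ring

theorem injective_dilation (n : ℕ) {s : ℝ} (hs : 0 < s) : Function.Injective (dilation n s) := by
  intro z w h
  simp only [dilation_apply, Prod.mk.injEq] at h
  refine Prod.ext (smul_right_injective _ hs.ne' h.1) (Prod.ext
    (smul_right_injective _ hs.ne' h.2.1) (mul_left_cancel₀ (by positivity) h.2.2))

theorem norm_dilation_le {n : ℕ} {s : ℝ} (hs : 0 ≤ s) (hs1 : s ≤ 1) (z : Heis n) :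
    ‖dilation n s z‖ ≤ s * ‖z‖ := by
  rw [dilation_apply, Prod.norm_def, Prod.norm_def, Prod.norm_def z, Prod.norm_def z.2]
  simp only [norm_smul, norm_mul, norm_pow, Real.norm_of_nonneg hs]
  have h2 : s ^ 2 * ‖z.2.2‖ ≤ s * ‖z.2.2‖ := by
    refine mul_le_mul_of_nonneg_right ?_ (norm_nonneg _)
    nlinarith
  refine max_le (mul_le_mul_of_nonneg_left (le_max_left _ _) hs) (max_le
    (mul_le_mul_of_nonneg_left ((le_max_left _ _).trans (le_max_right _ _)) hs)
    (h2.trans (mul_le_mul_of_nonneg_left ((le_max_right _ _).trans (le_max_right _ _)) hs)))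

theorem IsTest.comp_dilation {n : ℕ} {φ : Heis n → ℝ} (hφ : IsTest φ) {s : ℝ} (hs : 0 < s) :
    IsTest (φ ∘ dilation n s) :=
  ⟨hφ.1.comp (dilation n s).contDiff, hφ.2.comp_isClosedEmbedding
    (LinearMap.isClosedEmbedding_of_injective (f := (dilation n s : Heis n →ₗ[ℝ] Heis n))
      (LinearMap.ker_eq_bot.2 (injective_dilation n hs)))⟩

theorem hgrad_comp_dilation {n : ℕ} {φ : Heis n → ℝ} (hφ : IsTest φ) (s : ℝ) (z : Heis n) :
    hgrad (φ ∘ dilation n s) z = s • hgrad φ (dilation n s z) := by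
  have h : fderiv ℝ (φ ∘ dilation n s) z = (fderiv ℝ φ (dilation n s z)).comp (dilation n s) :=
    ((hφ.differentiable _).hasFDerivAt.comp z (dilation n s).hasFDerivAt).fderiv
  have hX : ∀ i, dilation n s (vecX i z) = s • vecX i (dilation n s z) := by
    intro i
    simp only [vecX, dilation_apply, Prod.smul_mk, smul_zero, Pi.smul_apply, smul_eq_mul]
    refine Prod.ext rfl (Prod.ext rfl ?_)
    change s ^ 2 * (2 * z.2.1 i) = s * (2 * (s * z.2.1 i))
    ring
  have hY : ∀ i, dilation n s (vecY i z) = s • vecY i (dilation n s z) := by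
    intro i
    simp only [vecY, dilation_apply, Prod.smul_mk, smul_zero, Pi.smul_apply, smul_eq_mul]
    refine Prod.ext rfl (Prod.ext rfl ?_)
    change s ^ 2 * -(2 * z.1 i) = s * -(2 * (s * z.1 i))
    ring
  ext i
  rcases i with i | i <;> simp [hgrad, h, hX, hY]

/-- The `L^Q` norm of the horizontal gradient is invariant under dilations. -/
theorem eLpNorm_hgrad_comp_dilation {n : ℕ} {φ : Heis n → ℝ} (hφ : IsTest φ) {s : ℝ}
    (hs : 0 < s) : eLpNorm (hgrad (φ ∘ dilation n s)) (homDim n) volume =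
      eLpNorm (hgrad φ) (homDim n) volume := by
  have hQ : homDim n ≠ 0 := by simp [homDim]
  have h1 : hgrad (φ ∘ dilation n s) = s • (hgrad φ ∘ dilation n s) :=
    funext fun z => hgrad_comp_dilation hφ s z
  have hmap : Measure.map (dilation n s) (volume : Measure (Heis n)) =
      ENNReal.ofReal ((s ^ homDim n)⁻¹) • volume := by
    have : ((volume : Measure (Fin n → ℝ)).prod (volume : Measure ℝ)).IsAddHaarMeasure :=
      Measure.prod.instIsAddHaarMeasure _ _
    have : (volume : Measure (Heis n)).IsAddHaarMeasure :=
      Measure.prod.instIsAddHaarMeasure (volume : Measure (Fin n → ℝ)) (volume.prod volume)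
    have h := Measure.map_linearMap_addHaar_eq_smul_addHaar (volume : Measure (Heis n))
      (f := (dilation n s : Heis n →ₗ[ℝ] Heis n)) (by rw [det_dilation]; positivity)
    rw [det_dilation, abs_of_pos (by positivity)] at h
    exact h
  -- The change of variables contributes `s^{-Q}`; its `Q`-th root cancels the factor `s` from the
  -- chain rule.
  have h2 : eLpNorm (hgrad φ ∘ dilation n s) (homDim n) volume =
      ENNReal.ofReal s⁻¹ * eLpNorm (hgrad φ) (homDim n) volume := by
    rw [← eLpNorm_map_measure hφ.continuous_hgrad.aestronglyMeasurable
      (dilation n s).continuous.aemeasurable, hmap,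
      eLpNorm_smul_measure_of_ne_top (ENNReal.natCast_ne_top _), smul_eq_mul]
    congr 1
    rw [ENNReal.toReal_div, ENNReal.toReal_one, ENNReal.toReal_natCast,
      ENNReal.ofReal_rpow_of_nonneg (by positivity) (by positivity), ← inv_pow, one_div,
      Real.pow_rpow_inv_natCast (by positivity) hQ]
  rw [h1, eLpNorm_const_smul, h2, ← mul_assoc, ← ofReal_norm, Real.norm_of_nonneg hs.le,
    ← ENNReal.ofReal_mul hs.le, mul_inv_cancel₀ hs.ne', ENNReal.ofReal_one, one_mul]

/-- There are cutoff functions `ρ_m` with values in `[0, 1]`, equal to `1` near any given compact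
set for large `m`, whose gradients are bounded in `L^Q`. -/
theorem exists_cutoff_seq (n : ℕ) : ∃ (ρ : ℕ → Heis n → ℝ) (_ : ∀ m, IsTest (ρ m)) (C : ℝ≥0∞),
    C ≠ ⊤ ∧ (∀ m z, |ρ m z| ≤ 1) ∧
    (∀ K : Set (Heis n), Bornology.IsBounded K → ∀ᶠ m in atTop, ∀ z ∈ K, ρ m z = 1) ∧
    ∀ m, eLpNorm (hgrad (ρ m)) (homDim n) volume ≤ C := by
  let χ : ContDiffBump (0 : Heis n) := ⟨1, 2, one_pos, one_lt_two⟩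
  have hχ : IsTest (χ : Heis n → ℝ) := ⟨χ.contDiff, χ.hasCompactSupport⟩
  have hs : ∀ m : ℕ, 0 < 1 / ((m : ℝ) + 1) := fun m => Nat.one_div_pos_of_nat
  refine ⟨fun m => χ ∘ dilation n (1 / ((m : ℝ) + 1)), fun m => hχ.comp_dilation (hs m),
    eLpNorm (hgrad χ) (homDim n) volume, (hχ.memLp_hgrad _).eLpNorm_ne_top, fun m z => ?_, ?_,
    fun m => (eLpNorm_hgrad_comp_dilation hχ (hs m)).le⟩
  · change |χ (dilation n _ z)| ≤ 1
    rw [abs_of_nonneg χ.nonneg]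
    exact χ.le_one
  · intro K hK
    obtain ⟨R, hR⟩ := hK.exists_norm_le
    filter_upwards [eventually_ge_atTop ⌈R⌉₊] with m hm z hz
    refine χ.one_of_mem_closedBall ?_
    have h1 : R ≤ (m : ℝ) + 1 := by
      have := (Nat.le_ceil R).trans (Nat.cast_le.2 hm)
      linarith
    rw [mem_closedBall_zero_iff]
    refine (norm_dilation_le (hs m).le ?_ z).trans ?_
    · rw [div_le_one (by positivity)]
      have : (0 : ℝ) ≤ m := Nat.cast_nonneg m
      linarith
    · change 1 / ((m : ℝ) + 1) * ‖z‖ ≤ 1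
      rw [one_div_mul_eq_div, div_le_one (by positivity)]
      exact (hR z hz).trans h1

namespace FSSpace

variable {n : ℕ} [NeZero n] {p : ℝ}

/-- Hölder with `1/2 = (Q-2)/(2Q) + 1/Q` bounds `u ∇_H ρ`. The constant depends on `ρ` only through
the scale-invariant norm `‖∇_H ρ‖_{L^Q}`, so it is uniform over the rescaled cutoffs. -/
theorem norm_mulMap_le {ρ : Heis n → ℝ} (hρ : IsTest ρ) (h1 : ∀ z, |ρ z| ≤ 1) {C : ℝ≥0∞}
    (hC : C ≠ ⊤) (hρC : eLpNorm (hgrad ρ) (homDim n) volume ≤ C) (w : Lp ℝ (sobExp n)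
      (volume : Measure (Heis n)) × Lp (HVec n) 2 (volume : Measure (Heis n))) :
    ‖mulMap hρ w‖ ≤ (1 + C.toReal) * ‖w‖ := by
  have hb : ‖(hρ.memLp ∞).toLp ρ‖ ≤ 1 := by
    rw [Lp.norm_toLp]
    refine ENNReal.toReal_le_of_le_ofReal zero_le_one ?_
    rw [eLpNorm_exponent_top]
    exact eLpNormEssSup_le_of_ae_bound (ae_of_all _ h1)
  have hg : ‖(hρ.memLp_hgrad (homDim n)).toLp (hgrad ρ)‖ ≤ C.toReal := by
    rw [Lp.norm_toLp]
    exact ENNReal.toReal_mono hC hρC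
  have hl : ∀ {E : Type} [NormedAddCommGroup E] [NormedSpace ℝ E],
      ‖ContinuousLinearMap.lsmul ℝ ℝ (E := E)‖ ≤ 1 := ContinuousLinearMap.opNorm_lsmul_le
  have hw1 : ‖w.1‖ ≤ ‖w‖ := norm_fst_le w
  have hw2 : ‖w.2‖ ≤ ‖w‖ := norm_snd_le w
  have hC0 : 0 ≤ C.toReal := ENNReal.toReal_nonneg
  have e1 : ‖(mulMap hρ w).1‖ ≤ 1 * 1 * ‖w‖ :=
    ((ContinuousLinearMap.lsmul ℝ ℝ).norm_holder_apply_apply_le _ _).trans (by gcongr; exacts [hl, hw1])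
  have e2 : ‖(mulMap hρ w).2‖ ≤ 1 * 1 * ‖w‖ + 1 * ‖w‖ * C.toReal :=
    (norm_add_le _ _).trans (add_le_add
      (((ContinuousLinearMap.lsmul ℝ ℝ).norm_holder_apply_apply_le _ _).trans
        (by gcongr; exacts [hl, hw2]))
      (((ContinuousLinearMap.lsmul ℝ ℝ).norm_holder_apply_apply_le _ _).trans
        (by gcongr; exacts [hl, hw1])))
  have := mul_nonneg hC0 (norm_nonneg w)
  exact max_le (by linarith) (by linarith)

/-- Multiplication by a suitable sequence of cutoff functions converges to the identity. -/
theorem tendsto_mulTest_cutoff {ρ : ℕ → Heis n → ℝ} (hρ : ∀ m, IsTest (ρ m))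
    (h1 : ∀ m z, |ρ m z| ≤ 1)
    (hK : ∀ K : Set (Heis n), Bornology.IsBounded K → ∀ᶠ m in atTop, ∀ z ∈ K, ρ m z = 1)
    {C : ℝ≥0∞} (hC : C ≠ ⊤) (hρC : ∀ m, eLpNorm (hgrad (ρ m)) (homDim n) volume ≤ C)
    (u : FSSpace n) : Tendsto (fun m => mulTest (hρ m) u) atTop (𝓝 u) := by
  refine tendsto_of_tendsto_val ?_
  change Tendsto (fun m => mulMap (hρ m) u.1) atTop (𝓝 u.1)
  obtain ⟨φ, hφ, hlim⟩ := exists_seq_ofTest u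
  set D : ℝ := 1 + C.toReal with hD
  have hD0 : 0 < D := by
    have : 0 ≤ C.toReal := ENNReal.toReal_nonneg
    positivity
  rw [Metric.tendsto_atTop]
  intro ε hε
  -- Uniformly bounded operators that eventually fix each element of a dense set converge strongly
  -- to the identity. The total error is at most `(D + 1)` times the approximation error, hence this
  -- choice.
  have hδ : 0 < ε / (2 * (D + 1)) := by positivity
  obtain ⟨k, hk⟩ := (Metric.tendsto_nhds.1 hlim _ hδ).exists
  obtain ⟨N, hN⟩ := eventually_atTop.1 (hK _ (hφ k).2.isBounded)
  refine ⟨N, fun m hm => ?_⟩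
  have hfix : mulMap (hρ m) (ofTest (hφ k)).1 = (ofTest (hφ k)).1 := by
    have e : mulTest (hρ m) (ofTest (hφ k)) = ofTest (hφ k) := by
      rw [mulTest_ofTest]
      have : ρ m * φ k = φ k := by
        funext z
        rw [Pi.mul_apply]
        by_cases hz : φ k z = 0
        · simp [hz]
        · rw [hN m hm z (subset_tsupport _ hz), one_mul]
      simp only [this]
    exact congrArg Subtype.val e
  set v := (ofTest (hφ k)).1
  rw [dist_eq_norm] at hk ⊢
  have e : mulMap (hρ m) u.1 - u.1 = mulMap (hρ m) (u.1 - v) + (v - u.1) := by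
    rw [map_sub, hfix]; abel
  rw [e]
  have h2 := norm_mulMap_le (hρ m) (h1 m) hC (hρC m) (u.1 - v)
  rw [norm_sub_rev] at h2
  have h3 : D * ‖v - u.1‖ + ‖v - u.1‖ ≤ (D + 1) * (ε / (2 * (D + 1))) := by
    have := mul_le_mul_of_nonneg_left hk.le (by positivity : 0 ≤ D + 1)
    linarith
  have h4 : (D + 1) * (ε / (2 * (D + 1))) = ε / 2 := by field_simp
  have h5 := norm_add_le (mulMap (hρ m) (u.1 - v)) (v - u.1)
  linarith

end FSSpace

/-! ### Extension from test functions to `S ∩ L^{p+1}` -/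

/-- The exponent `2 Q / (Q + 2)` dual to the critical Sobolev exponent. -/
def sobConj (n : ℕ) : ℝ≥0∞ := ENNReal.ofReal (2 * (homDim n : ℝ) / ((homDim n : ℝ) + 2))

instance sobConj_fact (n : ℕ) [NeZero n] : Fact (1 ≤ sobConj n) := by
  refine ⟨?_⟩
  have h := sobExp_aux n
  rw [sobConj, ← ENNReal.ofReal_one]
  refine ENNReal.ofReal_le_ofReal ?_
  rw [le_div_iff₀ (by linarith)]; linarith

instance sobConj_holder (n : ℕ) [NeZero n] : ENNReal.HolderConjugate (sobConj n) (sobExp n) := by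
  refine ⟨?_⟩
  have h := sobExp_aux n
  have h0 : (0 : ℝ) < homDim n := by linarith
  have h1 : (0 : ℝ) < 2 * (homDim n : ℝ) / ((homDim n : ℝ) - 2) := by positivity
  have h2 : (0 : ℝ) < 2 * (homDim n : ℝ) / ((homDim n : ℝ) + 2) := by positivity
  rw [sobExp, sobConj, ← ENNReal.ofReal_inv_of_pos h1, ← ENNReal.ofReal_inv_of_pos h2,
    ← ENNReal.ofReal_add (by positivity) (by positivity), inv_one, ← ENNReal.ofReal_one]
  congr 1
  field_simp
  ring

theorem isOpen_gaugeBall (n : ℕ) (R : ℝ) : IsOpen (gaugeBall n R) :=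
  isOpen_lt (by fun_prop) continuous_const

theorem exists_subset_gaugeBall {K : Set (Heis n)} (hK : IsCompact K) :
    ∃ k : {k : ℕ // 1 < k}, K ⊆ gaugeBall n k := by
  obtain ⟨R, hR⟩ := hK.exists_bound_of_continuousOn (f := fun z : Heis n =>
    Real.sqrt (z.2.2 ^ 2 + (∑ i, z.1 i ^ 2 + ∑ i, z.2.1 i ^ 2) ^ 2)) (by fun_prop)
  obtain ⟨k, hk⟩ := exists_nat_gt R
  -- The shift by `2` only secures an index greater than `1`.
  refine ⟨⟨k + 2, by omega⟩, fun z hz => ?_⟩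
  have h := (le_abs_self _).trans (hR z hz)
  change Real.sqrt _ < ((k + 2 : ℕ) : ℝ)
  push_cast
  linarith

namespace FSSpace

variable {n : ℕ} [NeZero n] {p : ℝ}

/-- The power `|u|^p` lies in `L^{(p+1)/p}`, and `(p+1)/p ≥ 2Q/(Q+2)` amounts to `p ≤ (Q+2)/(Q-2)`;
on a compact set the larger exponent gives the smaller one. This is where the restriction on `p`
from above enters. -/
theorem memLp_mul_signedPow (hp1 : 1 ≤ p) (hp2 : p < ((homDim n : ℝ) + 2) / ((homDim n : ℝ) - 2))
    {ρ : Heis n → ℝ} (hρ : IsTest ρ) {u : FSSpace n} (hu : MemPow p u) :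
    MemLp (fun z => ρ z * signedPow p (u.toFun z)) (sobConj n) volume := by
  have hQ := sobExp_aux n
  have hp0 : 0 < p := by linarith
  have hpq : 0 < (p + 1) / p := by positivity
  have hsm : AEStronglyMeasurable (fun z => signedPow p (u.toFun z)) volume :=
    (continuous_signedPow hp1).comp_aestronglyMeasurable hu.1
  have h1 : MemLp (fun z => signedPow p (u.toFun z)) (ENNReal.ofReal ((p + 1) / p)) volume := by
    rw [← integrable_norm_rpow_iff hsm (by simpa using hpq) ENNReal.ofReal_ne_top,
      ENNReal.toReal_ofReal hpq.le]
    refine (MemLp.integrable_abs_rpow hp1 hu).congr (ae_of_all _ fun z => ?_)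
    change _ = ‖signedPow p (u.toFun z)‖ ^ ((p + 1) / p)
    rw [Real.norm_eq_abs, abs_signedPow hp1, ← Real.rpow_mul (abs_nonneg _),
      mul_div_cancel₀ _ hp0.ne']
  have hK : IsCompact (tsupport ρ) := hρ.2
  have : IsFiniteMeasure ((volume : Measure (Heis n)).restrict (tsupport ρ)) :=
    ⟨by rw [Measure.restrict_apply_univ]; exact hK.measure_lt_top⟩
  have hle : sobConj n ≤ ENNReal.ofReal ((p + 1) / p) := by
    refine ENNReal.ofReal_le_ofReal ?_
    rw [lt_div_iff₀ hQ] at hp2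
    rw [div_le_div_iff₀ (by linarith) hp0]
    nlinarith
  have h2 : MemLp (fun z => signedPow p (u.toFun z)) (sobConj n)
      (volume.restrict (tsupport ρ)) := (h1.restrict _).mono_exponent hle
  have h3 : MemLp (fun z => ρ z * signedPow p (u.toFun z)) (sobConj n)
      (volume.restrict (tsupport ρ)) := h2.smul ((hρ.memLp ∞).restrict _)
  have h4 : Function.support (fun z => ρ z * signedPow p (u.toFun z)) ⊆ tsupport ρ := fun z hz =>
    subset_tsupport _ (left_ne_zero_of_mul (Function.mem_support.1 hz))
  rwa [← memLp_indicator_iff_restrict hK.measurableSet, indicator_eq_self.2 h4] at h3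

/-- Test functions approximating `g` in `S` need not converge in `L^{p+1}`. After multiplication by
`ρ` the power pairing is continuous on `L^{2Q/(Q-2)}`, where they do converge. Keeping two
coefficients `a, b` avoids dividing by a quantity that may vanish. -/
theorem mul_dirichlet_mulTest_eq (hp1 : 1 ≤ p)
    (hp2 : p < ((homDim n : ℝ) + 2) / ((homDim n : ℝ) - 2)) {u w : FSSpace n} (hu : MemPow p u)
    {a b : ℝ} (H : ∀ (φ : Heis n → ℝ) (hφ : IsTest φ),
      a * dirichlet w (ofTest hφ) = b * powPairing p u (ofTest hφ))
    {ρ : Heis n → ℝ} (hρ : IsTest ρ) (g : FSSpace n) :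
    a * dirichlet w (mulTest hρ g) = b * powPairing p u (mulTest hρ g) := by
  have hm := memLp_mul_signedPow hp1 hp2 hρ hu
  let P : Lp ℝ (sobExp n) (volume : Measure (Heis n)) →L[ℝ] ℝ :=
    (ContinuousLinearMap.lsmul ℝ ℝ).lpPairing volume (sobConj n) (sobExp n) (hm.toLp _)
  have hP : ∀ v : FSSpace n, P v.toFun = powPairing p u (mulTest hρ v) := by
    intro v
    rw [ContinuousLinearMap.lpPairing_eq_integral, powPairing]
    refine integral_congr_ae ?_
    filter_upwards [hm.coeFn_toLp, toFun_mulTest hρ v] with z h1 h2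
    rw [h1, h2, ContinuousLinearMap.lsmul_apply, smul_eq_mul]
    ring
  obtain ⟨φ, hφ, hlim⟩ := exists_seq_ofTest g
  have l1 : Tendsto (fun m => mulTest hρ (ofTest (hφ m))) atTop (𝓝 (mulTest hρ g)) :=
    tendsto_of_tendsto_val (((mulMap hρ).continuous.tendsto g.1).comp hlim)
  have l2 : Tendsto (fun m => a * dirichlet w (mulTest hρ (ofTest (hφ m)))) atTop
      (𝓝 (a * dirichlet w (mulTest hρ g))) :=
    (((dirichlet w).continuous.tendsto _).comp l1).const_mul a
  have l3 : Tendsto (fun m => b * P (ofTest (hφ m)).toFun) atTop (𝓝 (b * P g.toFun)) :=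
    ((P.continuous.tendsto _).comp ((continuous_fst.tendsto g.1).comp hlim)).const_mul b
  rw [← hP]
  refine tendsto_nhds_unique l2 (l3.congr fun m => ?_)
  rw [hP, mulTest_ofTest, H]

/-- Proportionality of the Dirichlet pairing and the power pairing passes from test functions to
`S_1^2 ∩ L^{p+1}`. -/
theorem mul_dirichlet_eq_of_test (hp1 : 1 ≤ p)
    (hp2 : p < ((homDim n : ℝ) + 2) / ((homDim n : ℝ) - 2)) {u w : FSSpace n} (hu : MemPow p u)
    {a b : ℝ} (H : ∀ (φ : Heis n → ℝ) (hφ : IsTest φ),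
      a * dirichlet w (ofTest hφ) = b * powPairing p u (ofTest hφ))
    {g : FSSpace n} (hg : MemPow p g) : a * dirichlet w g = b * powPairing p u g := by
  obtain ⟨ρ, hρ, C, hC, h1, hK, hρC⟩ := exists_cutoff_seq n
  -- The cutoffs are now removed: by convergence in `S` in the Dirichlet pairing, and by dominated
  -- convergence in the power pairing, where `g ∈ L^{p+1}` makes the majorant integrable.
  have l1 := (((dirichlet w).continuous.tendsto _).comp
    (tendsto_mulTest_cutoff hρ h1 hK hC hρC g)).const_mul a
  have hi := integrable_signedPow_mul hp1 hu hg
  have l2 : Tendsto (fun m => powPairing p u (mulTest (hρ m) g)) atTop (𝓝 (powPairing p u g)) := by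
    refine tendsto_integral_of_dominated_convergence
      (fun z => |signedPow p (u.toFun z) * g.toFun z|) (fun m => ?_) hi.abs (fun m => ?_) ?_
    · exact ((continuous_signedPow hp1).comp_aestronglyMeasurable hu.1).mul
        (Lp.aestronglyMeasurable _)
    · filter_upwards [toFun_mulTest (hρ m) g] with z hz
      rw [hz, mul_left_comm, norm_mul, Real.norm_eq_abs, Real.norm_eq_abs]
      exact mul_le_of_le_one_left (abs_nonneg _) (h1 m z)
    · filter_upwards [ae_all_iff.2 fun m => toFun_mulTest (hρ m) g] with z hz
      refine tendsto_const_nhds.congr' ?_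
      filter_upwards [hK {z} Bornology.isBounded_singleton] with m hm
      rw [hz m, hm z rfl, one_mul]
  refine tendsto_nhds_unique l1 ((l2.const_mul b).congr fun m => ?_)
  rw [Function.comp, mul_dirichlet_mulTest_eq hp1 hp2 hu H (hρ m) g]

/-! ### Generalized critical points -/

/-- The Lagrange multiplier rule on test functions, with the multiplier eliminated: it says that
`D_u` and `F_u` are proportional there, without naming the ratio. -/
theorem dirichlet_mul_powPairing_test (hp : 1 ≤ p) (ρ : ∀ k : {k : ℕ // 1 < k}, CutoffFun n k)
    {u : FSSpace n}
    (hu : IsGeneralizedCriticalOn (fun k => cutoffProj (ρ k)) energy (constraint n p) u)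
    {φ ψ : Heis n → ℝ} (hφ : IsTest φ) (hψ : IsTest ψ) :
    powPairing p u (ofTest hψ) * dirichlet u (ofTest hφ) =
      powPairing p u (ofTest hφ) * dirichlet u (ofTest hψ) := by
  obtain ⟨huM, us, hus, hder, hloc⟩ := hu
  obtain ⟨k, hk⟩ := exists_subset_gaugeBall (hφ.2.union hψ.2)
  have hk1 : ∀ z ∈ tsupport φ ∪ tsupport ψ, (ρ k).fn =ᶠ[𝓝 z] 1 := fun z hz => by
    filter_upwards [(isOpen_gaugeBall n k).mem_nhds (hk hz)] with y hy
    exact (ρ k).eq_one y hy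
  have hlk : Tendsto (fun j => ‖mulTest (ρ k).isTest (us j - u)‖) atTop (𝓝 0) := hloc k
  have Fφ := tendsto_powPairing_of_tendsto_mulTest hp (ρ k).isTest hφ (fun z hz =>
    (hk1 z (Or.inl (subset_tsupport _ hz))).eq_of_nhds) huM (fun j => (hus j).1) hlk
  have Fψ := tendsto_powPairing_of_tendsto_mulTest hp (ρ k).isTest hψ (fun z hz =>
    (hk1 z (Or.inr (subset_tsupport _ hz))).eq_of_nhds) huM (fun j => (hus j).1) hlk
  have Dφ := tendsto_dirichlet_of_tendsto_mulTest (ρ k).isTest hφ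
    (fun z hz => hk1 z (Or.inl hz)) hlk
  have Dψ := tendsto_dirichlet_of_tendsto_mulTest (ρ k).isTest hψ
    (fun z hz => hk1 z (Or.inr hz)) hlk
  -- The combination of `φ` and `ψ` annihilated by `F_{u_j}`, hence tangent to `M` at `u_j`.
  set v : ℕ → FSSpace n := fun j => powPairing p (us j) (ofTest hψ) • ofTest hφ +
    (-powPairing p (us j) (ofTest hφ)) • ofTest hψ with hv
  have hvlim := ((Fψ.smul_const (ofTest hφ)).add (Fφ.neg.smul_const (ofTest hψ))).norm
  -- One more than the norm of the limit of `v j`, so that `B⁻¹ • v j` eventually lies in the unit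
  -- ball over which `derivNormOn` takes its supremum.
  set B : ℝ := ‖powPairing p u (ofTest hψ) • ofTest hφ +
    (-powPairing p u (ofTest hφ)) • ofTest hψ‖ + 1 with hB
  have hB0 : 0 < B := by positivity
  have hvB : ∀ᶠ j in atTop, ‖v j‖ ≤ B :=
    (hvlim.eventually (gt_mem_nhds (lt_add_one _))).mono fun j hj => hj.le
  have hvm : ∀ j, MemPow p (v j) := fun j =>
    ((memPow_ofTest hφ).smul _).add ((memPow_ofTest hψ).smul _)
  have htan : ∀ j, B⁻¹ • v j ∈ tangentVectors (constraint n p) (us j) := fun j => by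
    have hm := ((mem_constraint_iff hp _).1 (hus j).1).1
    refine mem_tangentVectors hp (hus j).1 ((hvm j).smul _) ?_
    rw [powPairing_smul, powPairing_add hp hm ((memPow_ofTest hφ).smul _)
      ((memPow_ofTest hψ).smul _), powPairing_smul, powPairing_smul]
    ring
  have hle : ∀ᶠ j in atTop, ‖dirichlet (us j) (B⁻¹ • v j)‖ₑ ≤
      derivNormOn energy (constraint n p) (us j) := by
    filter_upwards [hvB] with j hj
    have hn : ‖B⁻¹ • v j‖ ≤ 1 := by
      rw [norm_smul, norm_inv, Real.norm_of_nonneg hB0.le, inv_mul_le_iff₀ hB0, mul_one]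
      exact hj
    rw [← fderiv_energy]
    exact le_iSup₂_of_le (B⁻¹ • v j) (htan j) (le_iSup_of_le hn le_rfl)
  have h0 : Tendsto (fun j => dirichlet (us j) (B⁻¹ • v j)) atTop (𝓝 0) :=
    tendsto_zero_iff_enorm_tendsto_zero.2 (tendsto_of_tendsto_of_tendsto_of_le_of_le'
      tendsto_const_nhds hder (Eventually.of_forall fun _ => zero_le) hle)
  have h1 := ((Fψ.mul Dφ).sub (Fφ.mul Dψ)).const_mul B⁻¹
  have h2 := tendsto_nhds_unique h0 (h1.congr fun j => by
    rw [map_smul, hv, map_add, map_smul, map_smul, smul_eq_mul, smul_eq_mul, smul_eq_mul]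
    ring)
  have h3 := (mul_eq_zero.1 h2.symm).resolve_left (inv_ne_zero hB0.ne')
  linarith

/-- A generalized critical point satisfies the Euler–Lagrange equation on `S_1^2 ∩ L^{p+1}`. -/
theorem dirichlet_eq_of_isGeneralizedCriticalOn (hp1 : 1 ≤ p)
    (hp2 : p < ((homDim n : ℝ) + 2) / ((homDim n : ℝ) - 2))
    (ρ : ∀ k : {k : ℕ // 1 < k}, CutoffFun n k) {u : FSSpace n}
    (hu : IsGeneralizedCriticalOn (fun k => cutoffProj (ρ k)) energy (constraint n p) u)
    {v : FSSpace n} (hv : MemPow p v) :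
    (p + 1) * dirichlet u v = ‖u‖ ^ 2 * powPairing p u v := by
  have hm := ((mem_constraint_iff hp1 u).1 hu.1).1
  have h1 : ∀ (ψ : Heis n → ℝ) (hψ : IsTest ψ),
      powPairing p u v * dirichlet u (ofTest hψ) = dirichlet u v * powPairing p u (ofTest hψ) := by
    intro ψ hψ
    have := mul_dirichlet_eq_of_test hp1 hp2 (w := u) (a := powPairing p u (ofTest hψ))
      (b := dirichlet u (ofTest hψ)) hm (fun φ hφ => by
        rw [dirichlet_mul_powPairing_test hp1 ρ hu hφ hψ, mul_comm]) hv
    linarith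
  -- The first slot already carries `v`; extending the second one to `u` itself identifies the
  -- multiplier as `‖u‖² / (p + 1)`.
  have h2 := mul_dirichlet_eq_of_test hp1 hp2 hm h1 hm
  rw [powPairing_self hp1 hu.1, dirichlet_self] at h2
  linarith

/-- Along a curve `γ` in `M`, `D_u(γ t) = ‖u‖² F_u(γ t) / (p + 1) ≤ ‖u‖² = D_u(u)`, so `t = 0` is a
maximum. Thus differentiability of `F_u ∘ γ` need not be established separately. -/
theorem isCriticalOn_of_dirichlet_eq (hp : 1 ≤ p) {u : FSSpace n} (hu : u ∈ constraint n p)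
    (H : ∀ v, MemPow p v → (p + 1) * dirichlet u v = ‖u‖ ^ 2 * powPairing p u v) :
    IsCriticalOn energy (constraint n p) u := by
  refine ⟨hu, (hasFDerivAt_energy u).differentiableAt, ?_⟩
  rintro v ⟨γ, -, hγM, hγ0, hγv⟩
  rw [fderiv_energy]
  have hp0 : 0 < p + 1 := by linarith
  have hd : HasDerivAt (fun t => dirichlet u (γ t)) (dirichlet u v) 0 :=
    (dirichlet u).hasFDerivAt.comp_hasDerivAt 0 hγv
  refine IsLocalMax.hasDerivAt_eq_zero (f := fun t => dirichlet u (γ t)) ?_ hd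
  filter_upwards [hγM] with t ht
  rw [hγ0, dirichlet_self]
  have h1 := H (γ t) ((mem_constraint_iff hp _).1 ht).1
  have h2 := mul_le_mul_of_nonneg_left (powPairing_le hp hu ht) (sq_nonneg ‖u‖)
  nlinarith

theorem exists_isWeakSolution_smul (hp : 1 < p) {u : FSSpace n} (hu : u ∈ constraint n p)
    (H : ∀ v, MemPow p v → (p + 1) * dirichlet u v = ‖u‖ ^ 2 * powPairing p u v) :
    ∃ c : ℝ, 0 < c ∧ IsWeakSolution p (c • u) := by
  have hp0 : 0 < p + 1 := by linarith
  have hm := ((mem_constraint_iff hp.le u).1 hu).1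
  have hu0 : u ≠ 0 := by
    rintro rfl
    have h := powPairing_self hp.le hu
    have h2 := powPairing_smul (p := p) (0 : FSSpace n) 0 0
    rw [zero_smul, zero_mul] at h2
    linarith
  have hlam : 0 < ‖u‖ ^ 2 / (p + 1) := by
    have := norm_pos_iff.2 hu0
    positivity
  -- Passing to `c u` multiplies `D_u` by `c` and `F_u` by `c^p`, so `c^{p-1}` must equal the
  -- multiplier `‖u‖² / (p + 1)`; solving for `c` requires `p ≠ 1`.
  set c : ℝ := (‖u‖ ^ 2 / (p + 1)) ^ (1 / (p - 1)) with hc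
  have hc0 : 0 < c := Real.rpow_pos_of_pos hlam _
  have hcp : c ^ p = c * (‖u‖ ^ 2 / (p + 1)) := by
    have h1 : c ^ (p - 1) = ‖u‖ ^ 2 / (p + 1) := by
      rw [hc, ← Real.rpow_mul hlam.le, one_div_mul_cancel (by linarith), Real.rpow_one]
    rw [← h1, mul_comm, ← Real.rpow_add_one hc0.ne']
    congr 1; ring
  refine ⟨c, hc0, (memPow_iff hp.le _).1 (hm.smul c), fun v hv => ?_⟩
  have hv' := (memPow_iff hp.le v).2 hv
  rw [← dirichlet_eq_integral]
  change _ = powPairing p (c • u) v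
  have e : powPairing p (c • u) v = c ^ p * powPairing p u v := by
    rw [powPairing, powPairing, ← integral_const_mul]
    refine integral_congr_ae ?_
    rw [toFun_smul]
    filter_upwards [Lp.coeFn_smul c u.toFun] with z hz
    rw [hz, Pi.smul_apply, smul_eq_mul, signedPow_mul _ _ hc0, mul_assoc]
  rw [e, hcp, dirichlet_comm, map_smul, dirichlet_comm, smul_eq_mul, mul_assoc]
  congr 1
  rw [div_mul_eq_mul_div, eq_div_iff hp0.ne', ← H v hv']
  ring

end FSSpace

end

theorem lemma3p3 {n : ℕ} [NeZero n] (p : ℝ) (hp1 : 1 ≤ p)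
    (hp2 : p < ((homDim n : ℝ) + 2) / ((homDim n : ℝ) - 2))
    (ρ : ∀ k : {k : ℕ // 1 < k}, CutoffFun n k) (u : FSSpace n)
    (hu : IsGeneralizedCriticalOn (fun k => FSSpace.cutoffProj (ρ k)) FSSpace.energy
      (FSSpace.constraint n p) u) :
    IsCriticalOn FSSpace.energy (FSSpace.constraint n p) u ∧
      (1 < p → ∃ c : ℝ, 0 < c ∧ FSSpace.IsWeakSolution p (c • u)) := by
  have H : ∀ v, FSSpace.MemPow p v → _ := fun v hv =>
    FSSpace.dirichlet_eq_of_isGeneralizedCriticalOn hp1 hp2 ρ hu hv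
  exact ⟨FSSpace.isCriticalOn_of_dirichlet_eq hp1 hu.1 H,
    fun hp => FSSpace.exists_isWeakSolution_smul hp hu.1 H⟩
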